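/- Let $K$ be a field and let $E=(E^0,E^1,s,r)$ be an arbitrary directed graph. The Leavitt path algebra $L_K(E)$ is the (not necessarily unital) $K$-algebra generated by the vertices $v\in E^0$, the edges $f\in E^1$ and ghost edges $f^*$ ($f\in E^1$), subject to the path algebra relations $vv'=\delta_{v,v'}v$, $s(f)f=f=f\,r(f)$, $r(f)f^*=f^*=f^*s(f)$ and the Cuntz–Krieger relations $f^*g=\delta_{f,g}\,r(f)$ for all edges $f,g$, and $v=\sum_{s(f)=v}ff^*$ for each vertex $v$ with $0<|s^{-1}(v)|<\infty$. Modules over $L=L_K(E)$ are left modules $M$ that are unital, i.e. $LM=M$; projectivity refers to the category of these modules, and $M$ is finitely presented if there is an exact sequence $Q\to P\to M\to 0$ with $P,Q$ finitely generated projective. Let $e=e_1\cdots e_N$ ($N\ge 1$) be a cycle in $E$: $r(e_i)=s(e_{i+1})$ for $i<N$, $r(e_N)=s(e_1)=:s(e)$, and $s(e_i)\ne s(e_j)$ for $i\neq j$. Let $p(x)=p_nx^n+\cdots+p_1x-1\in K[x]$ be irreducible of degree $n\ge 2$ with $p(0)=-1$, and put $p(e)=p_ne^n+\cdots+p_1e-s(e)\in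 L_K(E)$. Let $K'=K[x]/\langle p(x)\rangle$ and let $\overline x\in K'$ be the class of $x$, which is invertible. Let $[e^\infty]$ be the set of infinite paths in $E$ of the form $\lambda e^\infty$ with $\lambda$ a finite path, where $e^\infty=eee\cdots$. Let $V_{[e^\infty]}$ be the left $L_{K'}(E)$-module with $K'$-basis $[e^\infty]$ and the following action on $q=f_1f_2\cdots\in[e^\infty]$: $vq=q$ if $v=s(f_1)$ and $vq=0$ otherwise; $fq=ff_1f_2\cdots$ if $r(f)=s(f_1)$ and $fq=0$ otherwise; $f^*q=f_2f_3\cdots$ if $f=f_1$ and $f^*q=0$ otherwise. Let $\sigma=\sigma_{e,\overline x}$ be the $K'$-algebra automorphism of $L_{K'}(E)$ which sends $e_1\mapsto\overline x e_1$ and $e_1^*\mapsto\overline x^{-1}e_1^*$ and fixes all vertices and all other edges and ghost edges. Let $V^p_{[e^\infty]}$ be the abelian group $V_{[e^\infty]}$ with the action $\ell\star m=\sigma(i(\ell))m$ of $L_K(E)$, where $i:L_K(E)\to L_{K'}(E)$ is the natural map. Then $V^p_{[e^\infty]}$ is a finitely presented left $L_K(E)$-module. Moreover $L_K(E)p(e)\subseteq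 L_K(E)s(e)$, and, with $\iota$ the inclusion, $$0\to L_K(E)p(e)\xrightarrow{\ \iota\ }L_K(E)s(e)\xrightarrow{\ \ell\,\mapsto\,\sigma(i(\ell))e^\infty\ }V^p_{[e^\infty]}\to 0$$ is a projective resolution of $V^p_{[e^\infty]}$, that is, an exact sequence of unital left $L_K(E)$-modules in which $L_K(E)p(e)$ and $L_K(E)s(e)$ are projective. In particular $V^p_{[e^\infty]}\cong L_K(E)s(e)/L_K(E)p(e)$ as left $L_K(E)$-modules. -/

import Mathlib

universe u v w x z

open Polynomial

set_option linter.checkUnivs false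

noncomputable section

/-- A directed graph `(E⁰, E¹, s, r)`: arbitrary sets of vertices and edges, with source and range
functions. -/
structure DiGraph where
  /-- the vertices -/
  V : Type v
  /-- the edges -/
  E : Type w
  /-- the source of an edge -/
  src : E → V
  /-- the range of an edge -/
  tgt : E → V

/-- The generators of the Leavitt path algebra: the vertices `v`, the edges `f` and the ghost
edges `f*` (the latter two are the edges of the double graph). -/
inductive LeavittGen (E : DiGraph.{v, w}) : Type (max v w)
  | vertex (v : E.V) : LeavittGen E
  | edge (f : E.E) : LeavittGen E
  | ghost (f : E.E) : LeavittGen E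

/-- A Leavitt `E`-family in a (not necessarily unital) ring `A`: elements indexed by the vertices,
edges and ghost edges of `E` which satisfy the relations of the path algebra of the double graph
together with the Cuntz-Krieger relations (CK1) and (CK2). -/
structure LeavittFamily (E : DiGraph.{v, w}) (A : Type z) [NonUnitalRing A] where
  vertex : E.V → A
  edge : E.E → A
  ghost : E.E → A
  vertex_mul_self : ∀ v, vertex v * vertex v = vertex v
  vertex_mul_of_ne : ∀ v v', v ≠ v' → vertex v * vertex v' = 0
  src_mul_edge : ∀ f, vertex (E.src f) * edge f = edge f
  edge_mul_tgt : ∀ f, edge f * vertex (E.tgt f) = edge f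
  tgt_mul_ghost : ∀ f, vertex (E.tgt f) * ghost f = ghost f
  ghost_mul_src : ∀ f, ghost f * vertex (E.src f) = ghost f
  ck1_self : ∀ f, ghost f * edge f = vertex (E.tgt f)
  ck1_of_ne : ∀ f f', f ≠ f' → ghost f * edge f' = 0
  ck2 : ∀ (v : E.V) (hfin : {f : E.E | E.src f = v}.Finite), {f : E.E | E.src f = v}.Nonempty →
    vertex v = ∑ f ∈ hfin.toFinset, edge f * ghost f

section LeavittPathAlgebra

variable (K : Type u) [CommRing K] (E : DiGraph.{v, w})

/-- The free (associative, non-unital) `K`-algebra on the vertices, edges and ghost edges. -/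
abbrev FreeLeavitt : Type (max u v w) := MonoidAlgebra K (FreeSemigroup (LeavittGen E))

variable {E} in
/-- A generator as an element of the free algebra. -/
def FreeLeavitt.gen (x : LeavittGen E) : FreeLeavitt K E :=
  MonoidAlgebra.single (FreeSemigroup.of x) 1

open FreeLeavitt LeavittGen in
/-- The defining relations of the Leavitt path algebra: those of the path algebra of the double
graph of `E` (vertices are orthogonal idempotents, an edge is fixed by its source on the left and
by its range on the right, with the roles exchanged for ghost edges), (CK1), and (CK2) at each
vertex which emits a nonzero finite number of edges. -/
inductive LeavittRel : FreeLeavitt K E → FreeLeavitt K E → Prop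
  | vertex_mul_self (v : E.V) :
      LeavittRel (gen K (vertex v) * gen K (vertex v)) (gen K (vertex v))
  | vertex_mul_of_ne (v v' : E.V) (h : v ≠ v') :
      LeavittRel (gen K (vertex v) * gen K (vertex v')) 0
  | src_mul_edge (f : E.E) :
      LeavittRel (gen K (vertex (E.src f)) * gen K (edge f)) (gen K (edge f))
  | edge_mul_tgt (f : E.E) :
      LeavittRel (gen K (edge f) * gen K (vertex (E.tgt f))) (gen K (edge f))
  | tgt_mul_ghost (f : E.E) :
      LeavittRel (gen K (vertex (E.tgt f)) * gen K (ghost f)) (gen K (ghost f))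
  | ghost_mul_src (f : E.E) :
      LeavittRel (gen K (ghost f) * gen K (vertex (E.src f))) (gen K (ghost f))
  | ck1_self (f : E.E) :
      LeavittRel (gen K (ghost f) * gen K (edge f)) (gen K (vertex (E.tgt f)))
  | ck1_of_ne (f f' : E.E) (h : f ≠ f') :
      LeavittRel (gen K (ghost f) * gen K (edge f')) 0
  | ck2 (v : E.V) (hfin : {f : E.E | E.src f = v}.Finite)
      (hne : {f : E.E | E.src f = v}.Nonempty) :
      LeavittRel (gen K (vertex v)) (∑ f ∈ hfin.toFinset, gen K (edge f) * gen K (ghost f))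

/-- The congruence of `K`-algebras generated by the defining relations. (As there is no unit, a
ring congruence need not respect scalars, hence the scalar multiples of the relations.) -/
def leavittCon : RingCon (FreeLeavitt K E) :=
  ringConGen fun x y => ∃ (c : K) (a b : FreeLeavitt K E), LeavittRel K E a b ∧ x = c • a ∧ y = c • b

/-- The Leavitt path algebra `L_K(E)`, a not necessarily unital associative `K`-algebra: the
quotient of the free algebra on vertices, edges and ghost edges by the defining relations. -/
def LeavittPathAlgebra : Type (max u v w) := (leavittCon K E).Quotient

namespace LeavittPathAlgebra

instance : NonUnitalRing (LeavittPathAlgebra K E) :=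
  inferInstanceAs (NonUnitalRing (leavittCon K E).Quotient)

theorem con_smul (c : K) {x y : FreeLeavitt K E} (h : leavittCon K E x y) :
    leavittCon K E (c • x) (c • y) := by
  induction h with
  | of x y h =>
    obtain ⟨d, a, b, hab, rfl, rfl⟩ := h
    exact RingConGen.Rel.of _ _ ⟨c * d, a, b, hab, by rw [mul_smul], by rw [mul_smul]⟩
  | refl x => exact (leavittCon K E).refl _
  | symm _ ih => exact (leavittCon K E).symm ih
  | trans _ _ ih₁ ih₂ => exact (leavittCon K E).trans ih₁ ih₂
  | add _ _ ih₁ ih₂ =>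
    rw [smul_add, smul_add]
    exact (leavittCon K E).add ih₁ ih₂
  | mul _ h₂ ih₁ _ =>
    rw [← smul_mul_assoc, ← smul_mul_assoc]
    exact (leavittCon K E).mul ih₁ h₂

instance : SMul K (LeavittPathAlgebra K E) where
  smul c := Quotient.map' (c • ·) fun _ _ h => con_smul K E c h

/-- The quotient map from the free algebra. -/
def mk (x : FreeLeavitt K E) : LeavittPathAlgebra K E := RingCon.toQuotient (c := leavittCon K E) x

theorem mk_surjective : Function.Surjective (mk K E) := Quotient.mk''_surjective

theorem mk_add (x y : FreeLeavitt K E) : mk K E (x + y) = mk K E x + mk K E y := rfl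
theorem mk_mul (x y : FreeLeavitt K E) : mk K E (x * y) = mk K E x * mk K E y := rfl
theorem mk_smul (c : K) (x : FreeLeavitt K E) : mk K E (c • x) = c • mk K E x := rfl
theorem mk_zero : mk K E 0 = 0 := rfl

instance : Module K (LeavittPathAlgebra K E) where
  one_smul x := by obtain ⟨x, rfl⟩ := mk_surjective K E x; rw [← mk_smul, one_smul]
  mul_smul c d x := by
    obtain ⟨x, rfl⟩ := mk_surjective K E x; simp only [← mk_smul, mul_smul]
  smul_zero c := by rw [← mk_zero, ← mk_smul, smul_zero]
  smul_add c x y := by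
    obtain ⟨x, rfl⟩ := mk_surjective K E x
    obtain ⟨y, rfl⟩ := mk_surjective K E y
    simp only [← mk_smul, ← mk_add, smul_add]
  add_smul c d x := by
    obtain ⟨x, rfl⟩ := mk_surjective K E x; simp only [← mk_smul, ← mk_add, add_smul]
  zero_smul x := by
    obtain ⟨x, rfl⟩ := mk_surjective K E x; rw [← mk_smul, zero_smul, mk_zero]

instance : IsScalarTower K (LeavittPathAlgebra K E) (LeavittPathAlgebra K E) where
  smul_assoc c x y := by
    obtain ⟨x, rfl⟩ := mk_surjective K E x
    obtain ⟨y, rfl⟩ := mk_surjective K E y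
    simp only [← mk_smul, ← mk_mul, smul_eq_mul, smul_mul_assoc]

instance : SMulCommClass K (LeavittPathAlgebra K E) (LeavittPathAlgebra K E) where
  smul_comm c x y := by
    obtain ⟨x, rfl⟩ := mk_surjective K E x
    obtain ⟨y, rfl⟩ := mk_surjective K E y
    simp only [← mk_smul, ← mk_mul, smul_eq_mul, mul_smul_comm]

theorem mk_sum {ι : Type*} (s : Finset ι) (g : ι → FreeLeavitt K E) :
    mk K E (∑ i ∈ s, g i) = ∑ i ∈ s, mk K E (g i) :=
  map_sum ({ toFun := mk K E, map_zero' := rfl, map_add' := mk_add K E } :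
    FreeLeavitt K E →+ LeavittPathAlgebra K E) g s

theorem mk_eq_of_rel {a b : FreeLeavitt K E} (h : LeavittRel K E a b) : mk K E a = mk K E b :=
  (RingCon.eq _).2 (RingConGen.Rel.of _ _ ⟨1, a, b, h, by rw [one_smul], by rw [one_smul]⟩)

/-- The canonical Leavitt `E`-family of `L_K(E)`: the classes of vertices, edges, ghost edges. -/
def family : LeavittFamily E (LeavittPathAlgebra K E) where
  vertex v := mk K E (FreeLeavitt.gen K (.vertex v))
  edge f := mk K E (FreeLeavitt.gen K (.edge f))
  ghost f := mk K E (FreeLeavitt.gen K (.ghost f))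
  vertex_mul_self v := mk_eq_of_rel K E (.vertex_mul_self v)
  vertex_mul_of_ne v v' h := mk_eq_of_rel K E (.vertex_mul_of_ne v v' h)
  src_mul_edge f := mk_eq_of_rel K E (.src_mul_edge f)
  edge_mul_tgt f := mk_eq_of_rel K E (.edge_mul_tgt f)
  tgt_mul_ghost f := mk_eq_of_rel K E (.tgt_mul_ghost f)
  ghost_mul_src f := mk_eq_of_rel K E (.ghost_mul_src f)
  ck1_self f := mk_eq_of_rel K E (.ck1_self f)
  ck1_of_ne f f' h := mk_eq_of_rel K E (.ck1_of_ne f f' h)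
  ck2 v hfin hne := by
    rw [mk_eq_of_rel K E (.ck2 v hfin hne), mk_sum]
    rfl

section lift

variable {K E} {A : Type z} [NonUnitalRing A] [Module K A] [IsScalarTower K A A]
  [SMulCommClass K A A] (F : LeavittFamily E A)

/-- The elements of a Leavitt family, indexed by the generators. -/
def genMap : LeavittGen E → A
  | .vertex v => F.vertex v
  | .edge f => F.edge f
  | .ghost f => F.ghost f

/-- The homomorphism of `K`-algebras from the free algebra given by a Leavitt family. -/
def freeLift : FreeLeavitt K E →ₙₐ[K] A :=
  MonoidAlgebra.liftMagma K (FreeSemigroup.lift (genMap F))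

theorem freeLift_gen (x : LeavittGen E) : freeLift F (FreeLeavitt.gen K x) = genMap F x := by
  simp [freeLift, FreeLeavitt.gen]

theorem freeLift_rel {a b : FreeLeavitt K E} (h : LeavittRel K E a b) :
    freeLift F a = freeLift F b := by
  cases h <;> simp only [map_mul, map_zero, map_sum, freeLift_gen, genMap]
  · exact F.vertex_mul_self _
  · exact F.vertex_mul_of_ne _ _ ‹_›
  · exact F.src_mul_edge _
  · exact F.edge_mul_tgt _
  · exact F.tgt_mul_ghost _
  · exact F.ghost_mul_src _
  · exact F.ck1_self _
  · exact F.ck1_of_ne _ _ ‹_›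
  · exact F.ck2 _ _ ‹_›

theorem freeLift_con {a b : FreeLeavitt K E} (h : leavittCon K E a b) :
    freeLift F a = freeLift F b := by
  induction h with
  | of x y h =>
    obtain ⟨d, a, b, hab, rfl, rfl⟩ := h
    rw [map_smul, map_smul, freeLift_rel F hab]
  | refl x => rfl
  | symm _ ih => exact ih.symm
  | trans _ _ ih₁ ih₂ => exact ih₁.trans ih₂
  | add _ _ ih₁ ih₂ => rw [map_add, map_add, ih₁, ih₂]
  | mul _ _ ih₁ ih₂ => rw [map_mul, map_mul, ih₁, ih₂]

/-- The universal property of `L_K(E)`: the homomorphism of `K`-algebras given by a Leavitt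
family. -/
def lift : LeavittPathAlgebra K E →ₙₐ[K] A where
  toFun := Quotient.lift (s := (leavittCon K E).toSetoid) (freeLift F) fun _ _ h => freeLift_con F h
  map_smul' c x := by
    obtain ⟨x, rfl⟩ := mk_surjective K E x
    exact map_smul (freeLift F) c x
  map_zero' := map_zero (freeLift F)
  map_add' x y := by
    obtain ⟨x, rfl⟩ := mk_surjective K E x
    obtain ⟨y, rfl⟩ := mk_surjective K E y
    exact map_add (freeLift F) x y
  map_mul' x y := by
    obtain ⟨x, rfl⟩ := mk_surjective K E x
    obtain ⟨y, rfl⟩ := mk_surjective K E y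
    exact map_mul (freeLift F) x y

theorem lift_vertex (v : E.V) : lift F ((family K E).vertex v) = F.vertex v :=
  freeLift_gen F (.vertex v)
theorem lift_edge (f : E.E) : lift F ((family K E).edge f) = F.edge f :=
  freeLift_gen F (.edge f)
theorem lift_ghost (f : E.E) : lift F ((family K E).ghost f) = F.ghost f :=
  freeLift_gen F (.ghost f)

end lift

/-- The natural homomorphism `L_K(E) → L_{K'}(E)`, for a `K`-algebra `K'`: it maps every vertex,
edge and ghost edge to itself, and scalars `c ∈ K` to their images in `K'`. -/
def extend (K' : Type z) [CommRing K'] [Algebra K K'] :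
    LeavittPathAlgebra K E →ₙ+* LeavittPathAlgebra K' E :=
  letI : Module K (LeavittPathAlgebra K' E) := Module.compHom _ (algebraMap K K')
  haveI : IsScalarTower K (LeavittPathAlgebra K' E) (LeavittPathAlgebra K' E) :=
    ⟨fun c x y => smul_mul_assoc (algebraMap K K' c) x y⟩
  haveI : SMulCommClass K (LeavittPathAlgebra K' E) (LeavittPathAlgebra K' E) :=
    ⟨fun c x y => (mul_smul_comm (algebraMap K K' c) x y).symm⟩
  (lift (K := K) (family K' E) : LeavittPathAlgebra K E →ₙ+* LeavittPathAlgebra K' E)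

variable {K E}

/-- The Leavitt family obtained from the canonical one by rescaling one edge `g` to `a g` and its
ghost edge to `a⁻¹ g*`. -/
def gaugeFamily (g : E.E) (a : Kˣ) : LeavittFamily E (LeavittPathAlgebra K E) :=
  letI : DecidableEq E.E := Classical.decEq _
  let c : E.E → Kˣ := fun f => if f = g then a else 1
  { vertex := (family K E).vertex
    edge := fun f => (c f : K) • (family K E).edge f
    ghost := fun f => ((c f)⁻¹ : Kˣ).val • (family K E).ghost f
    vertex_mul_self := (family K E).vertex_mul_self
    vertex_mul_of_ne := (family K E).vertex_mul_of_ne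
    src_mul_edge := fun f => by rw [mul_smul_comm, (family K E).src_mul_edge]
    edge_mul_tgt := fun f => by rw [smul_mul_assoc, (family K E).edge_mul_tgt]
    tgt_mul_ghost := fun f => by rw [mul_smul_comm, (family K E).tgt_mul_ghost]
    ghost_mul_src := fun f => by rw [smul_mul_assoc, (family K E).ghost_mul_src]
    ck1_self := fun f => by
      rw [smul_mul_smul_comm, (family K E).ck1_self, Units.inv_mul, one_smul]
    ck1_of_ne := fun f f' h => by
      rw [smul_mul_smul_comm, (family K E).ck1_of_ne f f' h, smul_zero]
    ck2 := fun v hfin hne => by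
      simp only [smul_mul_smul_comm, Units.mul_inv, one_smul]
      exact (family K E).ck2 v hfin hne }

/-- The gauge automorphism which fixes all vertices and all edges and ghost edges other than
`g`, `g*`, and maps `g` to `a g` and `g*` to `a⁻¹ g*`. -/
def gauge (g : E.E) (a : Kˣ) : LeavittPathAlgebra K E →ₙₐ[K] LeavittPathAlgebra K E :=
  lift (gaugeFamily g a)

end LeavittPathAlgebra

end LeavittPathAlgebra

/-! ### Modules over rings without unit -/

/-- A left module over a not necessarily unital ring. -/
class LeftMod (R : Type u) (M : Type v) [NonUnitalRing R] [AddCommGroup M] extends SMul R M where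
  smul_add : ∀ (r : R) (m n : M), r • (m + n) = r • m + r • n
  add_smul : ∀ (r s : R) (m : M), (r + s) • m = r • m + s • m
  mul_smul : ∀ (r s : R) (m : M), (r * s) • m = r • s • m

namespace LeftMod

section

variable (R : Type u) [NonUnitalRing R]

/-- The left regular module. -/
instance regular : LeftMod R R where
  smul r s := r * s
  smul_add := mul_add
  add_smul := add_mul
  mul_smul := mul_assoc

/-- Restriction of a module structure along a ring homomorphism. -/
abbrev comp {R : Type u} {S : Type w} [NonUnitalRing R] [NonUnitalRing S] (f : R →ₙ+* S)
    {M : Type v} [AddCommGroup M] (_ : LeftMod S M) : LeftMod R M where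
  smul r m := f r • m
  smul_add r m n := LeftMod.smul_add (f r) m n
  add_smul r s m := by
    change f (r + s) • m = f r • m + f s • m
    rw [map_add, LeftMod.add_smul]
  mul_smul r s m := by
    change f (r * s) • m = f r • f s • m
    rw [map_mul, LeftMod.mul_smul]

/-- The module `M` is unital: `R M = M`, where `R M` is the additive subgroup generated by the
products `r m`. -/
def IsUnital (M : Type v) [AddCommGroup M] [LeftMod R M] : Prop :=
  AddSubgroup.closure {x : M | ∃ (r : R) (m : M), x = r • m} = ⊤

/-- Homomorphisms of left `R`-modules. -/
structure Hom (M : Type v) (N : Type w) [AddCommGroup M] [LeftMod R M] [AddCommGroup N]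
    [LeftMod R N] extends M →+ N where
  map_smul' : ∀ (r : R) (m : M), toFun (r • m) = r • toFun m

instance (M : Type v) (N : Type w) [AddCommGroup M] [LeftMod R M] [AddCommGroup N]
    [LeftMod R N] : CoeFun (Hom R M N) fun _ => M → N := ⟨fun f => f.toAddMonoidHom⟩

/-- Submodules of a left `R`-module. -/
structure Sub (M : Type v) [AddCommGroup M] [LeftMod R M] extends AddSubgroup M where
  smul_mem' : ∀ (r : R) {m : M}, m ∈ carrier → r • m ∈ carrier

end

variable {R : Type u} [NonUnitalRing R] {M : Type v} [AddCommGroup M] [LeftMod R M]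

instance (N : Sub R M) : LeftMod R N.toAddSubgroup where
  smul r m := ⟨r • m.1, N.smul_mem' r m.2⟩
  smul_add r m n := Subtype.ext (LeftMod.smul_add r m.1 n.1)
  add_smul r s m := Subtype.ext (LeftMod.add_smul r s m.1)
  mul_smul r s m := Subtype.ext (LeftMod.mul_smul r s m.1)

theorem smul_sub' (r : R) (m n : M) : r • (m - n) = r • m - r • n := by
  rw [eq_sub_iff_add_eq, ← LeftMod.smul_add, sub_add_cancel]

/-- The quotient of a module by a submodule. -/
instance (N : Sub R M) : LeftMod R (M ⧸ N.toAddSubgroup) where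
  smul r := Quotient.map' (r • ·) fun a b h => by
    rw [QuotientAddGroup.leftRel_apply] at h ⊢
    rw [neg_add_eq_sub] at h ⊢
    change r • b - r • a ∈ N.toAddSubgroup
    rw [← smul_sub']
    exact N.smul_mem' r h
  smul_add r m n := by
    induction m using QuotientAddGroup.induction_on with | _ m
    induction n using QuotientAddGroup.induction_on with | _ n
    exact congrArg (QuotientAddGroup.mk (s := N.toAddSubgroup)) (LeftMod.smul_add r m n)
  add_smul r s m := by
    induction m using QuotientAddGroup.induction_on with | _ m
    exact congrArg (QuotientAddGroup.mk (s := N.toAddSubgroup)) (LeftMod.add_smul r s m)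
  mul_smul r s m := by
    induction m using QuotientAddGroup.induction_on with | _ m
    exact congrArg (QuotientAddGroup.mk (s := N.toAddSubgroup)) (LeftMod.mul_smul r s m)

/-- The inclusion of a submodule in a larger one. -/
def Sub.inclusion {N P : Sub R M} (h : N.toAddSubgroup ≤ P.toAddSubgroup) :
    Hom R N.toAddSubgroup P.toAddSubgroup where
  toAddMonoidHom := AddSubgroup.inclusion h
  map_smul' _ _ := rfl

/-- For submodules `N` and `P`, the intersection `N ∩ P` as a submodule of `P`; this is `N` viewed
inside `P` if `N ≤ P`. -/
def Sub.within (N P : Sub R M) : Sub R P.toAddSubgroup where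
  toAddSubgroup := N.toAddSubgroup.addSubgroupOf P.toAddSubgroup
  smul_mem' r _ h := N.smul_mem' r h

/-- The left ideal `R x = {a x : a ∈ R}`. -/
def leftIdeal (x : R) : Sub R R where
  toAddSubgroup := (AddMonoidHom.mulRight x).range
  smul_mem' := by
    rintro r _ ⟨a, rfl⟩
    exact ⟨r * a, mul_assoc r a x⟩

variable (R)

/-- `M` is finitely generated: some finite subset of `M` lies in no proper submodule. -/
def IsFG (M : Type v) [AddCommGroup M] [LeftMod R M] : Prop :=
  ∃ s : Finset M, ∀ N : Sub R M, (∀ m ∈ s, m ∈ N.toAddSubgroup) → N.toAddSubgroup = ⊤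

/-- `P` is a projective object of the category of unital left `R`-modules: it is unital, and maps
out of it lift along surjective homomorphisms of unital modules (in the universe `z`). -/
def IsProjective (P : Type v) [AddCommGroup P] [LeftMod R P] : Prop :=
  IsUnital R P ∧
    ∀ (M N : Type z) [AddCommGroup M] [LeftMod R M] [AddCommGroup N] [LeftMod R N],
      IsUnital R M → IsUnital R N → ∀ (g : Hom R M N) (f : Hom R P N), Function.Surjective g →
        ∃ h : Hom R P M, ∀ x, g (h x) = f x

/-- `M` is finitely presented as a unital module: there is an exact sequence `Q → P → M → 0` with
`P` and `Q` finitely generated projective unital modules. (Over a ring with unit this is the usual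
notion; a ring without unit has no unital free modules of finite rank to present `M` by.) -/
def IsFinitelyPresented (M : Type v) [AddCommGroup M] [LeftMod R M] : Prop :=
  ∃ (Q P : Type u) (_ : AddCommGroup Q) (_ : LeftMod R Q) (_ : AddCommGroup P) (_ : LeftMod R P)
    (f : Hom R Q P) (g : Hom R P M),
    IsFG R Q ∧ IsProjective.{u, u, z} R Q ∧ IsFG R P ∧ IsProjective.{u, u, z} R P ∧
      Function.Exact f g ∧ Function.Surjective g

variable {R}

/-- `0 → Q → P → M → 0`, with maps `f` and `g`, is a projective resolution of `M` in the category
of unital modules. -/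
structure IsProjectiveResolution {Q : Type w} {P : Type x} [AddCommGroup Q] [LeftMod R Q]
    [AddCommGroup P] [LeftMod R P] (f : Hom R Q P) (g : Hom R P M) : Prop where
  unital : IsUnital R M
  projective_left : IsProjective.{u, w, z} R Q
  projective_right : IsProjective.{u, x, z} R P
  injective : Function.Injective f
  exact : Function.Exact f g
  surjective : Function.Surjective g

end LeftMod

/-! ### Infinite paths, cycles and Chen modules -/

namespace DiGraph

variable {E : DiGraph.{v, w}}

/-- An infinite path `q₀ q₁ q₂ …`. -/
structure InfPath (E : DiGraph.{v, w}) where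
  edge : ℕ → E.E
  chain : ∀ n, E.tgt (edge n) = E.src (edge (n + 1))

namespace InfPath

@[ext] theorem ext {q q' : E.InfPath} (h : ∀ n, q.edge n = q'.edge n) : q = q' := by
  cases q; cases q'; congr; exact funext h

/-- The path `f q`, for an edge `f` whose range is the source of `q`. -/
def cons (f : E.E) (q : E.InfPath) (h : E.tgt f = E.src (q.edge 0)) : E.InfPath where
  edge n := Nat.casesOn n f q.edge
  chain n := by
    cases n with
    | zero => exact h
    | succ n => exact q.chain n

/-- The path `q₁ q₂ …` obtained from `q₀ q₁ q₂ …` by removing the first edge. -/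
def tail (q : E.InfPath) : E.InfPath where
  edge n := q.edge (n + 1)
  chain n := q.chain (n + 1)

end InfPath

/-- A cycle `e = e₁ ⋯ e_N`, `N ≥ 1`: a closed path whose edges have pairwise different sources.
(Edges are numbered from `0`.) -/
structure Cycle (E : DiGraph.{v, w}) where
  length : ℕ
  length_pos : 0 < length
  edge : Fin length → E.E
  chain : ∀ (i : ℕ) (h : i + 1 < length),
    E.tgt (edge ⟨i, Nat.lt_of_succ_lt h⟩) = E.src (edge ⟨i + 1, h⟩)
  closed : E.tgt (edge ⟨length - 1, Nat.sub_lt length_pos Nat.one_pos⟩) =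
    E.src (edge ⟨0, length_pos⟩)
  src_ne : ∀ i j, i ≠ j → E.src (edge i) ≠ E.src (edge j)

namespace Cycle

/-- The first edge of a cycle. -/
def first (e : E.Cycle) : E.E := e.edge ⟨0, e.length_pos⟩

/-- The source `s(e)` of a cycle. -/
def base (e : E.Cycle) : E.V := E.src e.first

/-- The infinite path `e^∞ = e e e ⋯`. -/
def inf (e : E.Cycle) : E.InfPath where
  edge n := e.edge ⟨n % e.length, Nat.mod_lt n e.length_pos⟩
  chain n := by
    have hN := e.length_pos
    by_cases h : n % e.length + 1 < e.length
    · rw [e.chain _ h]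
      congr 3
      rw [Nat.add_mod, Nat.mod_eq_of_lt (a := 1) (by omega), Nat.mod_eq_of_lt h]
    · have hlt := Nat.mod_lt n hN
      have h1 : n % e.length = e.length - 1 := by omega
      have h2 : (n + 1) % e.length = 0 := by
        rw [← Nat.mod_add_mod, h1, Nat.sub_add_cancel hN, Nat.mod_self]
      simp only [h1, h2]
      exact e.closed

/-- The class `[e^∞]` of the infinite paths which are tail equivalent to `e^∞`, that is, of the form
`q = λ e^∞` for a finite path `λ` (consisting of the first `n` edges of `q`). -/
structure TailClass (e : E.Cycle) where
  path : E.InfPath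
  tail_eq : ∃ n, ∀ k, path.edge (n + k) = e.inf.edge k

namespace TailClass

variable {e : E.Cycle}

/-- The infinite path `e^∞` as an element of `[e^∞]`. -/
def inf (e : E.Cycle) : e.TailClass := ⟨e.inf, 0, fun k => by rw [Nat.zero_add]⟩

/-- The first edge of an infinite path. -/
def head (q : e.TailClass) : E.E := q.path.edge 0

/-- The source of an infinite path. -/
def src (q : e.TailClass) : E.V := E.src q.head

/-- The path `f q`. -/
def cons (f : E.E) (q : e.TailClass) (h : E.tgt f = q.src) : e.TailClass :=
  ⟨q.path.cons f h, q.tail_eq.elim fun n hn => ⟨n + 1, fun k => by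
    rw [Nat.add_right_comm]; exact hn k⟩⟩

/-- The path `q` without its first edge. -/
def tail (q : e.TailClass) : e.TailClass :=
  ⟨q.path.tail, q.tail_eq.elim fun n hn => ⟨n + e.length - 1, fun k => by
    have hN := e.length_pos
    change q.path.edge (n + e.length - 1 + k + 1) = _
    have : n + e.length - 1 + k + 1 = n + (e.length + k) := by omega
    rw [this, hn]
    simp only [Cycle.inf, Nat.add_mod_left]⟩⟩

theorem tail_cons (f : E.E) (q : e.TailClass) (h : E.tgt f = q.src) : (q.cons f h).tail = q := rfl
theorem head_cons (f : E.E) (q : e.TailClass) (h : E.tgt f = q.src) : (q.cons f h).head = f := rfl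
theorem src_cons (f : E.E) (q : e.TailClass) (h : E.tgt f = q.src) :
    (q.cons f h).src = E.src f := rfl
theorem tgt_head (q : e.TailClass) : E.tgt q.head = q.tail.src := q.path.chain 0

theorem cons_tail (q : e.TailClass) : q.tail.cons q.head q.tgt_head = q := by
  have : q.path.tail.cons q.head q.tgt_head = q.path := by
    ext n
    cases n <;> rfl
  cases q
  simp only [cons, tail] at this ⊢
  congr

end TailClass

end Cycle

end DiGraph

open DiGraph

section Chen

variable (K : Type u) [CommRing K] {E : DiGraph.{v, w}} (e : E.Cycle)

/-- The Chen module `V_{[e^∞]}`: the free `K`-module with basis `[e^∞]`. -/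
def ChenModule : Type (max u w) := e.TailClass →₀ K

namespace ChenModule

instance : AddCommGroup (ChenModule K e) := inferInstanceAs (AddCommGroup (e.TailClass →₀ K))
instance : Module K (ChenModule K e) := inferInstanceAs (Module K (e.TailClass →₀ K))

variable {e} in
/-- The basis element given by an infinite path. -/
def of (q : e.TailClass) : ChenModule K e := Finsupp.single q 1

/-- The `K`-linear endomorphism with prescribed values on the basis. -/
def linExt (g : e.TailClass → ChenModule K e) : Module.End K (ChenModule K e) :=
  Finsupp.linearCombination K g

theorem linExt_of (g : e.TailClass → ChenModule K e) (q : e.TailClass) :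
    linExt K e g (of K q) = g q := by
  have := Finsupp.linearCombination_single K (v := g) (1 : K) q
  rw [one_smul] at this
  exact this

theorem end_ext {f g : Module.End K (ChenModule K e)} (h : ∀ q, f (of K q) = g (of K q)) :
    f = g :=
  Finsupp.lhom_ext' fun q => LinearMap.ext_ring (h q)

open Classical in
/-- The action of vertices, edges and ghost edges on the basis `[e^∞]`: `v q = q` if `v = s(q)` and
`v q = 0` otherwise; `f q` is the concatenation if `r(f) = s(q)`, and `0` otherwise; `f* q` is `q`
without its first edge if that edge is `f`, and `0` otherwise. -/
def family : LeavittFamily E (Module.End K (ChenModule K e)) where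
  vertex v := linExt K e fun q => if v = q.src then of K q else 0
  edge f := linExt K e fun q => if h : E.tgt f = q.src then of K (q.cons f h) else 0
  ghost f := linExt K e fun q => if f = q.head then of K q.tail else 0
  vertex_mul_self v := end_ext K e fun q => by
    rw [Module.End.mul_apply, linExt_of]
    split_ifs with h <;> simp [linExt_of, h]
  vertex_mul_of_ne v v' hv := end_ext K e fun q => by
    rw [Module.End.mul_apply, linExt_of]
    split_ifs with h
    · rw [linExt_of, if_neg (fun h' => hv (h'.trans h.symm))]; rfl
    · simp
  src_mul_edge f := end_ext K e fun q => by
    rw [Module.End.mul_apply, linExt_of]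
    split_ifs with h
    · rw [linExt_of, Cycle.TailClass.src_cons, if_pos rfl]
    · simp
  edge_mul_tgt f := end_ext K e fun q => by
    rw [Module.End.mul_apply, linExt_of, linExt_of]
    split_ifs with h
    · rw [linExt_of, dif_pos h]
    · simp
  tgt_mul_ghost f := end_ext K e fun q => by
    rw [Module.End.mul_apply, linExt_of]
    split_ifs with h
    · rw [linExt_of, if_pos (h ▸ q.tgt_head)]
    · simp
  ghost_mul_src f := end_ext K e fun q => by
    rw [Module.End.mul_apply, linExt_of, linExt_of]
    by_cases h : f = q.head
    · rw [if_pos (h ▸ rfl), linExt_of]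
    · rw [if_neg h]
      split_ifs with h'
      · rw [linExt_of, if_neg h]
      · simp
  ck1_self f := end_ext K e fun q => by
    rw [Module.End.mul_apply, linExt_of, linExt_of]
    split_ifs with h
    · rw [linExt_of, Cycle.TailClass.head_cons, if_pos rfl, Cycle.TailClass.tail_cons]
    · simp
  ck1_of_ne f f' hf := end_ext K e fun q => by
    rw [Module.End.mul_apply, linExt_of]
    split_ifs with h
    · rw [linExt_of, Cycle.TailClass.head_cons, if_neg hf]; rfl
    · simp
  ck2 v hfin _ := end_ext K e fun q => by
    rw [LinearMap.sum_apply, linExt_of]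
    have key : ∀ f : E.E, ((linExt K e fun q => if h : E.tgt f = q.src then of K (q.cons f h) else 0)
        * (linExt K e fun q => if f = q.head then of K q.tail else 0) :
          Module.End K (ChenModule K e)) (of K q) = if f = q.head then of K q else 0 := by
      intro f
      rw [Module.End.mul_apply, linExt_of]
      split_ifs with h
      · subst h
        rw [linExt_of, dif_pos q.tgt_head, Cycle.TailClass.cons_tail]
      · simp
    simp only [key]
    rw [Finset.sum_ite_eq' hfin.toFinset q.head]
    simp only [Set.Finite.mem_toFinset, Set.mem_ofPred_eq, Cycle.TailClass.src]
    exact if_congr eq_comm rfl rfl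

/-- The action of `L_K(E)` on `V_{[e^∞]}`. -/
def rep : LeavittPathAlgebra K E →ₙₐ[K] Module.End K (ChenModule K e) :=
  LeavittPathAlgebra.lift (family K e)

instance : LeftMod (LeavittPathAlgebra K E) (ChenModule K e) where
  smul l m := rep K e l m
  smul_add l m n := map_add (rep K e l) m n
  add_smul l l' m := by
    change rep K e (l + l') m = rep K e l m + rep K e l' m
    rw [map_add, LinearMap.add_apply]
  mul_smul l l' m := by
    change rep K e (l * l') m = rep K e l (rep K e l' m)
    rw [map_mul, Module.End.mul_apply]

/-- The homomorphism `ρ : L_K(E) → V_{[e^∞]}`, `l ↦ l e^∞`. -/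
def rho : LeftMod.Hom (LeavittPathAlgebra K E) (LeavittPathAlgebra K E) (ChenModule K e) where
  toFun l := l • (of K (Cycle.TailClass.inf e) : ChenModule K e)
  map_zero' := by
    change rep K e 0 _ = 0
    rw [map_zero, LinearMap.zero_apply]
  map_add' l l' := LeftMod.add_smul l l' _
  map_smul' l l' := LeftMod.mul_smul l l' _

end ChenModule

variable {K}

/-- The twisted Chen module `V_{[e^∞]}^{σ_{e,a}}`: the abelian group `V_{[e^∞]}` with the action
`l ⋆ m = σ_{e,a}(l) m`, where `σ_{e,a}` is the gauge automorphism which multiplies the first edge of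
`e` by `a`. -/
def TwistedChenModule (_ : Kˣ) : Type (max u w) := ChenModule K e

instance (a : Kˣ) : AddCommGroup (TwistedChenModule e a) :=
  inferInstanceAs (AddCommGroup (ChenModule K e))

instance (a : Kˣ) : LeftMod (LeavittPathAlgebra K E) (TwistedChenModule e a) :=
  LeftMod.comp (LeavittPathAlgebra.gauge e.first a :
    LeavittPathAlgebra K E →ₙ+* LeavittPathAlgebra K E)
    (inferInstanceAs (LeftMod (LeavittPathAlgebra K E) (ChenModule K e)))

/-- The class of `x` in `K[x]/(p(x))` as a unit, if `p(0) = -1`: for `p = p_n x^n + ⋯ + p_1 x - 1`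
its inverse is the class of `p_n x^(n-1) + ⋯ + p_1`. -/
def rootUnit (p : K[X]) (hp : p.eval 0 = -1) : (AdjoinRoot p)ˣ :=
  have h : AdjoinRoot.root p * AdjoinRoot.mk p p.divX = 1 := by
    have h1 := congrArg (AdjoinRoot.mk p) (X_mul_divX_add p)
    rw [AdjoinRoot.mk_self, coeff_zero_eq_eval_zero, hp] at h1
    simpa [add_neg_eq_zero] using h1
  ⟨AdjoinRoot.root p, AdjoinRoot.mk p p.divX, h, (mul_comm _ _).trans h⟩

/-- A basic irreducible polynomial of degree at least `2`. -/
structure IsBasicIrreducible {K : Type u} [Field K] (p : K[X]) : Prop where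
  irreducible : Irreducible p
  two_le_natDegree : 2 ≤ p.natDegree
  eval_zero : p.eval 0 = -1

/-- The module `V^p_{[e^∞]}` over `L_K(E)`: with `K' = K[x]/(p(x))`, the twisted Chen module of
`L_{K'}(E)` given by the class of `x`, restricted along the natural map `L_K(E) → L_{K'}(E)`. -/
def ChenModulePoly (p : K[X]) (hp : p.eval 0 = -1) : Type (max u w) :=
  TwistedChenModule e (rootUnit p hp)

namespace ChenModulePoly

variable (p : K[X]) (hp : p.eval 0 = -1)

instance : AddCommGroup (ChenModulePoly e p hp) :=
  inferInstanceAs (AddCommGroup (TwistedChenModule e (rootUnit p hp)))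

instance : LeftMod (LeavittPathAlgebra K E) (ChenModulePoly e p hp) :=
  LeftMod.comp (LeavittPathAlgebra.extend K E (AdjoinRoot p))
    (inferInstanceAs (LeftMod (LeavittPathAlgebra (AdjoinRoot p) E)
      (TwistedChenModule e (rootUnit p hp))))

end ChenModulePoly

/-- The powers of `x` with `x⁰ = v`: for elements `v = v²`, `v x = x = x v` of a ring without
unit. -/
def powFrom {A : Type z} [Mul A] (v x : A) : ℕ → A
  | 0 => v
  | k + 1 => powFrom v x k * x

/-- The value `p(x) = p_n x^n + ⋯ + p_1 x + p_0 v` of the polynomial `p` at `x`, with constant term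
evaluated at `v`. -/
def evalFrom {A : Type z} [NonUnitalRing A] [Module K A] (v x : A) (p : K[X]) : A :=
  p.sum fun k c => c • powFrom v x k

namespace DiGraph.Cycle

variable (K)

/-- The vertex `s(e)` as an element of `L_K(E)`. -/
def baseElem : LeavittPathAlgebra K E := (LeavittPathAlgebra.family K E).vertex e.base

/-- The cycle `e = e₁ ⋯ e_N` as an element of `L_K(E)`, written as the product
`s(e) e₁ ⋯ e_N`. -/
def elem : LeavittPathAlgebra K E :=
  ((List.ofFn e.edge).map (LeavittPathAlgebra.family K E).edge).foldl (· * ·) (e.baseElem K)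

variable {K}

/-- The element `p(e)` of `L_K(E)`. -/
def evalElem (p : K[X]) : LeavittPathAlgebra K E := evalFrom (e.baseElem K) (e.elem K) p

variable (K)

/-- The left `L_K(E)`-module `L_K(E) s(e)`. -/
def baseIdeal : LeftMod.Sub (LeavittPathAlgebra K E) (LeavittPathAlgebra K E) :=
  LeftMod.leftIdeal (e.baseElem K)

variable {K}

/-- The left `L_K(E)`-module `L_K(E) p(e)`. -/
def evalIdeal (p : K[X]) : LeftMod.Sub (LeavittPathAlgebra K E) (LeavittPathAlgebra K E) :=
  LeftMod.leftIdeal (e.evalElem p)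

end DiGraph.Cycle

/-- The map `ρ ∘ σ ∘ i : L_K(E) s(e) → V^p_{[e^∞]}`: the natural map `i` to `L_{K'}(E)`, followed by
the gauge automorphism `σ` given by `e` and the class of `x` in `K' = K[x]/(p(x))`, followed by
`ρ : l ↦ l e^∞`, where `L_{K'}(E)` acts on the untwisted module `V_{[e^∞]}`. -/
def ChenModulePoly.toChen (p : K[X]) (hp : p.eval 0 = -1) :
    LeftMod.Hom (LeavittPathAlgebra K E) (e.baseIdeal K).toAddSubgroup (ChenModulePoly e p hp) where
  toFun l := ChenModule.rho (AdjoinRoot p) e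
    (LeavittPathAlgebra.gauge e.first (rootUnit p hp)
      (LeavittPathAlgebra.extend K E (AdjoinRoot p) l.1))
  map_zero' := by
    rw [ZeroMemClass.coe_zero, map_zero, map_zero, map_zero]
    rfl
  map_add' l l' := by
    rw [AddSubgroup.coe_add, map_add, map_add, map_add]
    rfl
  map_smul' r l := by
    change (ChenModule.rho (AdjoinRoot p) e (LeavittPathAlgebra.gauge e.first (rootUnit p hp)
      (LeavittPathAlgebra.extend K E (AdjoinRoot p) (r * l.1))) : ChenModule (AdjoinRoot p) e) = _
    rw [map_mul, map_mul]
    exact (ChenModule.rho (AdjoinRoot p) e).map_smul' _ _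

end Chen

end

/-! Regard `L = L_K(E)` as a `K[x]`-module on which `x` acts by right multiplication by `e`; this
commutes with left multiplication. For a commutative `K`-algebra `A` and a unit `a`, let `L` act on
the Chen module over `A` twisted by `a`. The path `e^∞` then satisfies `s(e) ⋆ e^∞ = e^∞` and `e ⋆
e^∞ = a e^∞`, and the module is universal for this: an element `w` of another `A`-linear
representation with `e w = a w` is the image of `e^∞` under an equivariant map
(`exists_equivariant`).

Let `A` be a `K[x]`-algebra in which `x` maps to `a`, and apply this to `A ⊗ L` over `K[x]` with `w
= 1 ⊗ s(e)`. The resulting map sends `l ⋆ e^∞` to `1 ⊗ l s(e)`, so `l ⋆ e^∞ = 0` forces `1 ⊗ l s(e)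
= 0` (`one_tmul_eq_zero_of_twistedRep`). No normal form for elements of `L` is needed. Two choices
of `A` give the theorem.

For `A = K[x]/(p)` the tensor product is `L/pL`, so the kernel of `L s(e) → V^p` lies in `L p(e)`.
The converse holds because `p(e)` acts on `e^∞` as `p(x̄) = 0`.

For `A = K[x, x⁻¹]`, a domain, suppose `l = l s(e)` and `l p(e) = 0`. Then `p · (l ⋆ e^∞) = 0` in a
free `A`-module, so `l ⋆ e^∞ = 0` and `l` is killed by a power of `x`. It is also killed by `p`,
which is coprime to `x`, hence `l = 0`. So right multiplication by `p(e)` is an isomorphism `L s(e)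
≅ L p(e)`, and `L p(e)` inherits projectivity and finite generation from the left ideal of the
idempotent `s(e)`. -/

noncomputable section

open DiGraph

/-! ### Induction on elements of `L_K(E)`, and extension of scalars -/

namespace LeavittPathAlgebra

section

variable {K : Type u} [CommRing K] {E : DiGraph.{v, w}}

/-- A property closed under sums, scalar multiples and products holds on `L_K(E)` if it holds on
the generators. -/
theorem induction_on {P : LeavittPathAlgebra K E → Prop} (l : LeavittPathAlgebra K E)
    (zero : P 0) (add : ∀ a b, P a → P b → P (a + b)) (smul : ∀ (c : K) a, P a → P (c • a))
    (mul : ∀ a b, P a → P b → P (a * b)) (vertex : ∀ v, P ((family K E).vertex v))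
    (edge : ∀ f, P ((family K E).edge f)) (ghost : ∀ f, P ((family K E).ghost f)) : P l := by
  obtain ⟨y, rfl⟩ := mk_surjective K E l
  induction y using MonoidAlgebra.induction_linear with
  | zero => exact zero
  | add a b ha hb => exact add _ _ ha hb
  | single g c =>
    have hg : P (mk K E (MonoidAlgebra.single g 1)) := by
      induction g using FreeSemigroup.recOnMul with
      | ih1 x =>
        cases x with
        | vertex v => exact vertex v
        | edge f => exact edge f
        | ghost f => exact ghost f
      | ih2 x y hx hy =>
        have := mul _ _ hx hy
        rwa [← mk_mul, MonoidAlgebra.single_mul_single, one_mul] at this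
    have := smul c _ hg
    rwa [← mk_smul, MonoidAlgebra.smul_single, smul_eq_mul, mul_one] at this

variable (K E) (A : Type z) [CommRing A] [Algebra K A]

/-- The `K`-module structure of `L_A(E)` which is used by `extend`. -/
abbrev scalarModule : Module K (LeavittPathAlgebra A E) := Module.compHom _ (algebraMap K A)

attribute [local instance] scalarModule

theorem scalarModule_isScalarTower :
    IsScalarTower K (LeavittPathAlgebra A E) (LeavittPathAlgebra A E) :=
  ⟨fun c x y => smul_mul_assoc (algebraMap K A c) x y⟩

theorem scalarModule_smulCommClass :
    SMulCommClass K (LeavittPathAlgebra A E) (LeavittPathAlgebra A E) :=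
  ⟨fun c x y => (mul_smul_comm (algebraMap K A c) x y).symm⟩

attribute [local instance] scalarModule_isScalarTower scalarModule_smulCommClass

/-- `extend` is bundled only as a ring homomorphism; its compatibility with scalars comes from the
`K`-linear lift that defines it. -/
theorem extend_smul (c : K) (l : LeavittPathAlgebra K E) :
    extend K E A (c • l) = algebraMap K A c • extend K E A l :=
  map_smul (lift (K := K) (family A E)) c l

theorem extend_vertex (v : E.V) :
    extend K E A ((family K E).vertex v) = (family A E).vertex v :=
  lift_vertex (K := K) (family A E) v

theorem extend_edge (f : E.E) :
    extend K E A ((family K E).edge f) = (family A E).edge f :=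
  lift_edge (K := K) (family A E) f

theorem extend_ghost (f : E.E) :
    extend K E A ((family K E).ghost f) = (family A E).ghost f :=
  lift_ghost (K := K) (family A E) f

end

end LeavittPathAlgebra

/-! ### The twisted action on the basis of infinite paths -/

section TwistedRep

open LeavittPathAlgebra ChenModule

variable {K : Type u} [CommRing K] {E : DiGraph.{v, w}} (e : E.Cycle) {A : Type z} [CommRing A]
  [Algebra K A] (a : Aˣ)

open Classical in
/-- The scalar by which the gauge automorphism `σ_{e,a}` multiplies an edge. -/
def DiGraph.Cycle.weight (f : E.E) : Aˣ := if f = e.first then a else 1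

variable (K) in
/-- The action `l ⋆ m = σ_{e,a}(i(l)) m` of `L_K(E)` on `V_{[e^∞]}` over a `K`-algebra `A`. -/
def twistedRep : LeavittPathAlgebra K E →ₙ+* Module.End A (ChenModule A e) :=
  ((rep A e : LeavittPathAlgebra A E →ₙ+* Module.End A (ChenModule A e)).comp
    (gauge e.first a : LeavittPathAlgebra A E →ₙ+* LeavittPathAlgebra A E)).comp (extend K E A)

theorem twistedRep_apply (l : LeavittPathAlgebra K E) :
    twistedRep K e a l = rep A e (gauge e.first a (extend K E A l)) := rfl

theorem twistedRep_smul (c : K) (l : LeavittPathAlgebra K E) :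
    twistedRep K e a (c • l) = algebraMap K A c • twistedRep K e a l := by
  rw [twistedRep_apply, extend_smul, map_smul, map_smul, twistedRep_apply]

open Classical in
theorem twistedRep_vertex_of (v : E.V) (q : e.TailClass) :
    twistedRep K e a ((LeavittPathAlgebra.family K E).vertex v) (of A q) =
      if v = q.src then of A q else 0 := by
  rw [twistedRep_apply, extend_vertex, LeavittPathAlgebra.gauge, lift_vertex]
  exact (congrArg (· (of A q)) (lift_vertex (K := A) (ChenModule.family A e) v)).trans
    (linExt_of ..)

open Classical in
theorem twistedRep_edge_of (f : E.E) (q : e.TailClass) :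
    twistedRep K e a ((LeavittPathAlgebra.family K E).edge f) (of A q) =
      if h : E.tgt f = q.src then e.weight a f • of A (q.cons f h) else 0 := by
  have h1 : (gaugeFamily e.first a).edge f =
      (e.weight a f : A) • (LeavittPathAlgebra.family A E).edge f := by
    simp only [gaugeFamily, Cycle.weight]

  rw [twistedRep_apply, extend_edge, LeavittPathAlgebra.gauge, lift_edge, h1, map_smul]
  refine (congrArg (fun φ => (e.weight a f : A) • φ (of A q))
    (lift_edge (K := A) (ChenModule.family A e) f)).trans ?_
  refine (congrArg ((e.weight a f : A) • ·) (linExt_of ..)).trans ?_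
  split_ifs
  · rfl
  · exact smul_zero _

open Classical in
theorem twistedRep_ghost_of (f : E.E) (q : e.TailClass) :
    twistedRep K e a ((LeavittPathAlgebra.family K E).ghost f) (of A q) =
      if f = q.head then (e.weight a f)⁻¹ • of A q.tail else 0 := by
  have h1 : (gaugeFamily e.first a).ghost f =
      ((e.weight a f)⁻¹ : Aˣ).val • (LeavittPathAlgebra.family A E).ghost f := by
    simp only [gaugeFamily, Cycle.weight]

  rw [twistedRep_apply, extend_ghost, LeavittPathAlgebra.gauge, lift_ghost, h1, map_smul]
  refine (congrArg (fun φ => ((e.weight a f)⁻¹ : Aˣ).val • φ (of A q))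
    (lift_ghost (K := A) (ChenModule.family A e) f)).trans ?_
  refine (congrArg (((e.weight a f)⁻¹ : Aˣ).val • ·) (linExt_of ..)).trans ?_
  split_ifs
  · rfl
  · exact smul_zero _

end TwistedRep

end

noncomputable section

open DiGraph

/-! ### Initial segments of infinite paths and recursion on `[e^∞]` -/

namespace DiGraph

variable {E : DiGraph.{v, w}}

namespace InfPath

/-- The list of the first `n` edges of an infinite path. -/
def take (q : E.InfPath) (n : ℕ) : List E.E := List.ofFn fun i : Fin n => q.edge i

theorem take_zero (q : E.InfPath) : q.take 0 = [] := List.ofFn_zero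

theorem take_succ (q : E.InfPath) (n : ℕ) : q.take (n + 1) = q.edge 0 :: q.tail.take n :=
  List.ofFn_succ

theorem take_add {n : ℕ} (m : ℕ) {q q' : E.InfPath} (h : ∀ k, q.edge (n + k) = q'.edge k) :
    q.take (n + m) = q.take n ++ q'.take m := by
  induction n generalizing q with
  | zero =>
    obtain rfl : q = q' := InfPath.ext fun k => by rw [← h, Nat.zero_add]
    rw [Nat.zero_add, take_zero, List.nil_append]
  | succ n ih =>
    rw [Nat.add_right_comm, take_succ, take_succ, List.cons_append, ih]
    intro k
    rw [← h, Nat.add_right_comm]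
    rfl

end InfPath

namespace Cycle

variable (e : E.Cycle)

/-- The edges of a cycle, as a list. -/
def edges : List E.E := List.ofFn e.edge

theorem edge_injective : Function.Injective e.edge := fun i j h => by
  by_contra hij
  exact e.src_ne i j hij (congrArg E.src h)

theorem take_inf_length : e.inf.take e.length = e.edges := by
  simp only [InfPath.take, edges, inf]
  congr 1
  funext i
  congr
  exact Nat.mod_eq_of_lt i.2

theorem inf_edge_length_add (k : ℕ) : e.inf.edge (e.length + k) = e.inf.edge k := by
  simp only [Cycle.inf, Nat.add_mod_left]

/-- Distinct sources make the edges of a cycle distinct. The first edge therefore occurs only once,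
and the gauge automorphism multiplies `e` by exactly one factor `a`. -/
theorem edges_eq_cons : ∃ l, e.edges = e.first :: l ∧ e.first ∉ l := by
  obtain ⟨N, hN⟩ : ∃ N, e.length = N + 1 := ⟨e.length - 1, (Nat.sub_add_cancel e.length_pos).symm⟩
  have h := e.take_inf_length
  rw [hN, InfPath.take_succ] at h
  have h0 : e.inf.edge 0 = e.first := by
    simp only [inf, first, Nat.zero_mod]
  have hnd : e.edges.Nodup := List.nodup_ofFn.2 e.edge_injective
  rw [h0] at h
  rw [← h] at hnd
  exact ⟨_, h.symm, (List.nodup_cons.1 hnd).1⟩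

theorem length_le_of_inf_edge {m : ℕ} (hm : m ≠ 0) (h : e.inf.edge m = e.inf.edge 0) :
    e.length ≤ m := by
  by_contra! hlt
  have := congrArg Fin.val (e.edge_injective h)
  simp only [Nat.mod_eq_of_lt hlt, Nat.zero_mod] at this
  exact hm this

variable {e} {W : Type*} {G : E.E → W → W} {w : W}

/-- A nonzero period `m` of `e^∞` is at least the length of `e`, and subtracting that length leaves
a period. The first `m` edges thus form a power of `e`, and each copy of `e` fixes `w`. -/
theorem foldr_take_inf (hw : e.edges.foldr G w = w) (m : ℕ)
    (hm : ∀ k, e.inf.edge (m + k) = e.inf.edge k) : (e.inf.take m).foldr G w = w := by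
  induction m using Nat.strong_induction_on with
  | _ m ih =>
    rcases eq_or_ne m 0 with rfl | h0
    · rfl
    · obtain ⟨m', rfl⟩ := Nat.exists_eq_add_of_le (e.length_le_of_inf_edge h0 (hm 0))
      rw [InfPath.take_add m' e.inf_edge_length_add, List.foldr_append, ih, take_inf_length, hw]
      · have := e.length_pos
        omega
      · intro k
        rw [← hm k, Nat.add_assoc, inf_edge_length_add]

/-- Independence of the presentation `q = λ e^∞`: the lengths of two admissible `λ` differ by a
period of `e^∞`. -/
theorem foldr_take_eq (hw : e.edges.foldr G w = w) {n m : ℕ} (hnm : n ≤ m) {q : E.InfPath}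
    (hn : ∀ k, q.edge (n + k) = e.inf.edge k) (hm : ∀ k, q.edge (m + k) = e.inf.edge k) :
    (q.take n).foldr G w = (q.take m).foldr G w := by
  obtain ⟨d, rfl⟩ := Nat.exists_eq_add_of_le hnm
  rw [InfPath.take_add d hn, List.foldr_append, foldr_take_inf hw]
  intro k
  rw [← hm k, Nat.add_assoc, hn]

/-- A function on `[e^∞]` is determined by its value at `e^∞` and its behaviour under prolongation
of paths by edges; the only compatibility condition is that the prolongation of `e^∞` by `e` be
`e^∞`. -/
theorem TailClass.exists_rec (hw : e.edges.foldr G w = w) :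
    ∃ t : e.TailClass → W, t (.inf e) = w ∧ ∀ f q h, t (cons f q h) = G f (t q) := by
  have key (q : e.TailClass) (n : ℕ) (hn : ∀ k, q.path.edge (n + k) = e.inf.edge k) :
      (q.path.take q.tail_eq.choose).foldr G w = (q.path.take n).foldr G w := by
    rcases le_total q.tail_eq.choose n with h | h
    · exact foldr_take_eq hw h q.tail_eq.choose_spec hn
    · exact (foldr_take_eq hw h hn q.tail_eq.choose_spec).symm
  -- The value at `q = λ e^∞` is `λ` applied to `w` through `G`, for a chosen `λ`. By `key` the
  -- choice may be replaced by length `0` for `e^∞`, and by the length chosen for `q` plus one for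
  -- `f q`.
  refine ⟨fun q => (q.path.take q.tail_eq.choose).foldr G w, ?_, fun f q h => ?_⟩
  · exact key (.inf e) 0 fun k => by rw [Nat.zero_add]; rfl
  · refine (key (cons f q h) (q.tail_eq.choose + 1) fun k => ?_).trans ?_
    · rw [Nat.add_right_comm]
      exact q.tail_eq.choose_spec k
    · rw [InfPath.take_succ]
      rfl

theorem prod_weight {A : Type*} [CommRing A] (a : Aˣ) :
    (e.edges.map (e.weight a)).prod = a := by
  obtain ⟨l, hl, hf⟩ := e.edges_eq_cons
  rw [hl, List.map_cons, List.prod_cons, List.prod_eq_one, mul_one, weight, if_pos rfl]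
  intro b hb
  obtain ⟨f, hfl, rfl⟩ := List.mem_map.1 hb
  exact if_neg (by rintro rfl; exact hf hfl)

end Cycle

end DiGraph

/-! ### Universal property of the twisted Chen module -/

section Equivariant

open LeavittPathAlgebra ChenModule

variable {K : Type u} [CommRing K] {E : DiGraph.{v, w}} {e : E.Cycle} {A : Type z} [CommRing A]
  {a : Aˣ} {W : Type*} [AddCommGroup W] [Module A W]

theorem foldr_inv_smul (b : E.E → Aˣ) (g : E.E → Module.End A W) (l : List E.E) (x : W) :
    l.foldr (fun f y => (b f)⁻¹ • g f y) x = (l.map b).prod⁻¹ • l.foldr (fun f y => g f y) x := by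
  induction l with
  | nil => simp
  | cons f l ih =>
    rw [List.foldr_cons, List.foldr_cons, ih, List.map_cons, List.prod_cons, mul_inv, mul_smul,
      Units.smul_def (_ : Aˣ)⁻¹ (List.foldr _ _ _), map_smul]
    rfl

variable (ρ : LeavittPathAlgebra K E →ₙ+* Module.End A W)

theorem map_foldl_apply (y : LeavittPathAlgebra K E) (l : List (LeavittPathAlgebra K E)) (x : W) :
    ρ (l.foldl (· * ·) y) x = ρ y (l.foldr (fun z => ρ z) x) := by
  induction l generalizing y with
  | nil => rfl
  | cons z l ih => rw [List.foldl_cons, ih, map_mul, Module.End.mul_apply]; rfl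

/-- The leading factor `s(e)` in `elem` is absorbed by the first edge, since a cycle has at least
one edge. -/
theorem map_elem_apply (x : W) : ρ (e.elem K) x =
    e.edges.foldr (fun f y => ρ ((LeavittPathAlgebra.family K E).edge f) y) x := by
  obtain ⟨l, hl, -⟩ := e.edges_eq_cons
  rw [Cycle.elem, ← Cycle.edges, map_foldl_apply, List.foldr_map, hl, List.foldr_cons,
    ← Module.End.mul_apply, ← map_mul, Cycle.baseElem]
  exact congrArg (fun y => ρ y _) ((LeavittPathAlgebra.family K E).src_mul_edge _)

/-- The twisted module `V_{[e^∞]}` is the universal module with an element `w` such that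
`s(e) w = w` and `e w = a w`. -/
theorem exists_equivariant [Algebra K A]
    (hK : ∀ (c : K) l x, ρ (c • l) x = algebraMap K A c • ρ l x) {w : W}
    (he : ρ (e.elem K) w = a • w) :
    ∃ ψ : ChenModule A e →ₗ[A] W, ψ (of A (.inf e)) = w ∧
      ∀ l m, ψ (twistedRep K e a l m) = ρ l (ψ m) := by
  classical
  let F := LeavittPathAlgebra.family K E
  -- As `f ⋆ q` is the path `f q` times the weight of `f`, equivariance forces the value at `f q` to
  -- be the inverse weight times `f` applied to the value at `q`. Going once around `e` gives `a⁻¹ e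
  -- w = w`, the compatibility that the recursion requires.
  have hw : e.edges.foldr (fun f y => (e.weight a f)⁻¹ • ρ (F.edge f) y) w = w := by
    rw [foldr_inv_smul, ← map_elem_apply, Cycle.prod_weight, he, inv_smul_smul]
  obtain ⟨t, ht, htc⟩ := Cycle.TailClass.exists_rec hw
  have htail (q : e.TailClass) : t q = (e.weight a q.head)⁻¹ • ρ (F.edge q.head) (t q.tail) := by
    conv_lhs => rw [← q.cons_tail]
    exact htc ..
  have hmul (x y : LeavittPathAlgebra K E) (m : W) : ρ x (ρ y m) = ρ (x * y) m := by
    rw [map_mul, Module.End.mul_apply]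
  have hunit (b : Aˣ) (x : LeavittPathAlgebra K E) (m : W) : ρ x (b • m) = b • ρ x m :=
    map_smul (ρ x) (b : A) m
  have hsrc (q : e.TailClass) : ρ (F.vertex q.src) (t q) = t q := by
    rw [htail, hunit, hmul, Cycle.TailClass.src, F.src_mul_edge]
  have hne (v : E.V) (q : e.TailClass) (h : v ≠ q.src) : ρ (F.vertex v) (t q) = 0 := by
    rw [← hsrc, hmul, F.vertex_mul_of_ne _ _ h, map_zero, LinearMap.zero_apply]
  let ψ : ChenModule A e →ₗ[A] W := Finsupp.linearCombination A t
  have hψ (q : e.TailClass) : ψ (of A q) = t q :=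
    (Finsupp.linearCombination_single A (v := t) (1 : A) q).trans (one_smul ..)
  have hψu (b : Aˣ) (m : ChenModule A e) : ψ (b • m) = b • ψ m := map_smul ψ (b : A) m
  -- Both sides are `A`-linear in `m`, so for each generator it suffices to test on basis paths.
  have hext (l : LeavittPathAlgebra K E)
      (h : ∀ q, ψ (twistedRep K e a l (of A q)) = ρ l (t q)) :
      ∀ m, ψ (twistedRep K e a l m) = ρ l (ψ m) := by
    have : ψ ∘ₗ twistedRep K e a l = ρ l ∘ₗ ψ :=
      Finsupp.lhom_ext' fun q => LinearMap.ext_ring <| (h q).trans (congrArg (ρ l) (hψ q).symm)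
    exact fun m => LinearMap.congr_fun this m
  refine ⟨ψ, (hψ _).trans ht, fun l => ?_⟩
  induction l using LeavittPathAlgebra.induction_on with
  | zero => simp
  | add x y hx hy => intro m; simp [hx, hy]
  | smul c x hx => intro m; rw [hK, twistedRep_smul, LinearMap.smul_apply, map_smul, hx]
  | mul x y hx hy => intro m; rw [map_mul, map_mul, Module.End.mul_apply, hx, hy]; rfl
  | vertex v =>
    refine hext _ fun q => ?_
    rw [twistedRep_vertex_of]
    split_ifs with h
    · rw [hψ, h, hsrc]
    · rw [hne v q h, map_zero]
  | edge f =>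
    refine hext _ fun q => ?_
    rw [twistedRep_edge_of]
    split_ifs with h
    · rw [hψu, hψ, htc, smul_inv_smul]
    · rw [← F.edge_mul_tgt, ← hmul, hne _ q h, map_zero, map_zero]
  | ghost f =>
    refine hext _ fun q => ?_
    rw [twistedRep_ghost_of, htail, hunit, hmul]
    split_ifs with h
    · rw [h, F.ck1_self, q.tgt_head, hsrc, hψu, hψ]
    · rw [F.ck1_of_ne f _ h, map_zero, map_zero, LinearMap.zero_apply, smul_zero]

variable [Algebra K A]

/-- Writing `q = λ q'`, each edge of `λ` prolongs the path and contributes its weight. The case `λ =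
e`, `q = q' = e^∞` gives the eigenvalue `a`. -/
theorem foldr_twistedRep {n : ℕ} {q q' : e.TailClass}
    (h : ∀ k, q.path.edge (n + k) = q'.path.edge k) :
    (q.path.take n).foldr
      (fun f y => twistedRep K e a ((LeavittPathAlgebra.family K E).edge f) y) (of A q') =
      ((q.path.take n).map (e.weight a)).prod • of A q := by
  induction n generalizing q with
  | zero =>
    obtain rfl : q = q' := by
      obtain ⟨p, hp⟩ := q
      obtain ⟨p', hp'⟩ := q'
      obtain rfl : p = p' := InfPath.ext fun k => by simpa using h k
      rfl
    simp [InfPath.take_zero]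
  | succ n ih =>
    have ih' := ih (q := q.tail) fun k => by
      rw [← h, Nat.add_right_comm]
      rfl
    rw [InfPath.take_succ, List.foldr_cons, List.map_cons, List.prod_cons]
    refine (congrArg _ ih').trans ?_
    rw [Units.smul_def, map_smul]
    refine (congrArg _ ((twistedRep_edge_of ..).trans (dif_pos q.tgt_head))).trans ?_
    refine (congrArg _ (congrArg (_ • of A ·) q.cons_tail)).trans ?_
    rw [mul_comm, mul_smul]
    rfl

theorem twistedRep_elem_inf :
    twistedRep K e a (e.elem K) (of A (.inf e)) = a • of A (.inf e) := by
  rw [map_elem_apply]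
  have := foldr_twistedRep (K := K) (a := a) (q := .inf e) (q' := .inf e) e.inf_edge_length_add
  rw [show (Cycle.TailClass.inf e).path = e.inf from rfl, Cycle.take_inf_length,
    Cycle.prod_weight] at this
  exact this

theorem twistedRep_base_inf :
    twistedRep K e a (e.baseElem K) (of A (.inf e)) = of A (.inf e) := by
  classical
  rw [Cycle.baseElem, twistedRep_vertex_of, if_pos]
  simp only [Cycle.TailClass.src, Cycle.TailClass.head, Cycle.TailClass.inf, Cycle.inf, Cycle.base,
    Cycle.first, Nat.zero_mod]

end Equivariant

end

noncomputable section

open DiGraph LeavittPathAlgebra ChenModule TensorProduct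

/-! ### Polynomials in the cycle, and `L_K(E)` as a `K[x]`-module -/

section EvalFrom

variable {K : Type u} [CommRing K] {A : Type z} [NonUnitalRing A] [Module K A] {y v x : A}

theorem evalFrom_add (p q : K[X]) : evalFrom v x (p + q) = evalFrom v x p + evalFrom v x q :=
  sum_add_index _ _ _ (fun _ => zero_smul _ _) fun _ _ _ => add_smul _ _ _

theorem evalFrom_monomial (n : ℕ) (c : K) : evalFrom v x (monomial n c) = c • powFrom v x n :=
  sum_monomial_index _ _ (zero_smul _ _)

theorem mul_powFrom (hv : y * v = v) (n : ℕ) : y * powFrom v x n = powFrom v x n := by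
  induction n with
  | zero => exact hv
  | succ n ih => rw [powFrom, ← mul_assoc, ih]

theorem powFrom_mul (hv : v * y = v) (hx : x * y = x) (n : ℕ) :
    powFrom v x n * y = powFrom v x n := by
  cases n with
  | zero => exact hv
  | succ n => rw [powFrom, mul_assoc, hx]

theorem mul_evalFrom [SMulCommClass K A A] (hv : y * v = v) (p : K[X]) :
    y * evalFrom v x p = evalFrom v x p := by
  simp only [evalFrom, Polynomial.sum, Finset.mul_sum, mul_smul_comm, mul_powFrom hv]

theorem evalFrom_mul [IsScalarTower K A A] (hv : v * y = v) (hx : x * y = x) (p : K[X]) :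
    evalFrom v x p * y = evalFrom v x p := by
  simp only [evalFrom, Polynomial.sum, Finset.sum_mul, smul_mul_assoc, powFrom_mul hv hx]

end EvalFrom

namespace DiGraph.Cycle

variable {K : Type u} [CommRing K] {E : DiGraph.{v, w}} (e : E.Cycle)

theorem baseElem_mul_self : e.baseElem K * e.baseElem K = e.baseElem K :=
  (LeavittPathAlgebra.family K E).vertex_mul_self _

theorem mul_foldl {R : Type*} [Semigroup R] (x y : R) (l : List R) :
    x * l.foldl (· * ·) y = l.foldl (· * ·) (x * y) := by
  induction l generalizing y with
  | nil => rfl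
  | cons z l ih => rw [List.foldl_cons, List.foldl_cons, ih, mul_assoc]

theorem baseElem_mul_elem : e.baseElem K * e.elem K = e.elem K := by
  rw [elem, mul_foldl, baseElem_mul_self]

theorem elem_mul_baseElem : e.elem K * e.baseElem K = e.elem K := by
  obtain ⟨N, hN, g, hc, hcl, hs⟩ := e
  -- Only the last edge matters, as its range is `s(e)`; a successor length lets it be split off the
  -- list.
  obtain ⟨N, rfl⟩ : ∃ n, N = n + 1 := ⟨N - 1, (Nat.sub_add_cancel hN).symm⟩
  simp only [elem, List.ofFn_succ', mul_assoc, baseElem, base,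
    first, List.concat_eq_append, List.map_append, List.foldl_append, List.map_cons, List.map_nil,
    List.foldl_cons, List.foldl_nil]
  congr 1
  have h := (LeavittPathAlgebra.family K E).edge_mul_tgt (g (Fin.last N))
  have h' : E.tgt (g (Fin.last N)) = E.src (g ⟨0, hN⟩) := hcl
  rw [h'] at h
  exact h

theorem baseElem_mul_evalElem (p : K[X]) : e.baseElem K * e.evalElem p = e.evalElem p :=
  mul_evalFrom e.baseElem_mul_self p

theorem evalElem_mul_baseElem (p : K[X]) : e.evalElem p * e.baseElem K = e.evalElem p :=
  evalFrom_mul e.baseElem_mul_self e.elem_mul_baseElem p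

variable (K)

/-- `L_K(E)` as a module over `K[x]`, where `x` acts by right multiplication by the cycle `e`. -/
abbrev PolyModule : Type (max u v w) := Module.AEval' (LinearMap.mulRight K (e.elem K))

/-- The identification of `L_K(E)` with the `K[x]`-module given by the cycle `e`. -/
def toPoly : LeavittPathAlgebra K E ≃ₗ[K] e.PolyModule K :=
  Module.AEval'.of (LinearMap.mulRight K (e.elem K))

variable {K}

theorem toPoly_mul_elem (l : LeavittPathAlgebra K E) :
    e.toPoly K (l * e.elem K) = (X : K[X]) • e.toPoly K l :=
  (Module.AEval'.X_smul_of (LinearMap.mulRight K (e.elem K)) l).symm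

theorem toPoly_symm_X_smul (m : e.PolyModule K) :
    (e.toPoly K).symm ((X : K[X]) • m) = (e.toPoly K).symm m * e.elem K :=
  Module.AEval'.of_symm_X_smul (LinearMap.mulRight K (e.elem K)) m

theorem C_smul_poly (c : K) (m : e.PolyModule K) : (C c : K[X]) • m = c • m :=
  Module.AEval.C_smul ..

/-- A constant acts through `K[x]` as a scalar, but enters `q(e)` as a multiple of `s(e)`. The two
actions are reconciled by a right factor `s(e)`, which is harmless because `e = s(e) e = e s(e)`. -/
theorem toPoly_symm_smul_mul (q : K[X]) (m : e.PolyModule K) :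
    (e.toPoly K).symm (q • m) * e.baseElem K = (e.toPoly K).symm m * e.evalElem q := by
  induction q using Polynomial.induction_on' with
  | add p q hp hq =>
    rw [add_smul, map_add, add_mul, hp, hq, evalElem, evalElem, evalElem, evalFrom_add, mul_add]
  | monomial n c =>
    rw [evalElem, evalFrom_monomial, ← C_mul_X_pow_eq_monomial, mul_smul, C_smul_poly, map_smul,
      mul_smul_comm, smul_mul_assoc]
    congr 1
    induction n with
    | zero => rw [pow_zero, one_smul, powFrom]
    | succ n ih =>
      rw [pow_succ', mul_smul, toPoly_symm_X_smul, mul_assoc, elem_mul_baseElem, powFrom,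
        ← mul_assoc, ← ih, mul_assoc, baseElem_mul_elem]

theorem toPoly_symm_smul {l : LeavittPathAlgebra K E} (hl : l * e.baseElem K = l) (q : K[X]) :
    (e.toPoly K).symm (q • e.toPoly K l) = l * e.evalElem q := by
  induction q using Polynomial.induction_on' with
  | add p q hp hq =>
    rw [add_smul, map_add, hp, hq, evalElem, evalElem, evalElem, evalFrom_add, mul_add]
  | monomial n c =>
    rw [evalElem, evalFrom_monomial, ← C_mul_X_pow_eq_monomial, mul_smul, C_smul_poly, map_smul,
      mul_smul_comm]
    congr 1
    induction n with
    | zero => rw [pow_zero, one_smul, powFrom, LinearEquiv.symm_apply_apply, hl]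
    | succ n ih => rw [pow_succ', mul_smul, toPoly_symm_X_smul, ih, powFrom, mul_assoc]

variable (K)

/-- The action of `L_K(E)` on itself by left multiplication is linear over `K[x]`. -/
def leftMulPoly : LeavittPathAlgebra K E →ₙ+* Module.End K[X] (e.PolyModule K) where
  toFun l := LinearMap.ofAEval _ ((e.toPoly K).toLinearMap ∘ₗ LinearMap.mulLeft K l) fun y => by
    change e.toPoly K (l * (y * e.elem K)) = _
    rw [← mul_assoc, toPoly_mul_elem]
    rfl
  map_zero' := by
    ext y
    exact congrArg (e.toPoly K) (zero_mul _)
  map_add' l l' := by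
    ext y
    exact congrArg (e.toPoly K) (add_mul _ _ _)
  map_mul' l l' := by
    ext y
    exact congrArg (e.toPoly K) (mul_assoc _ _ _)

end DiGraph.Cycle

/-! ### Evaluation at `e^∞`: a bound on the kernel, and surjectivity -/

section Kernel

variable {K : Type u} [CommRing K] {E : DiGraph.{v, w}} {e : E.Cycle} {A : Type z} [CommRing A]
  [Algebra K A] [Algebra K[X] A] [IsScalarTower K K[X] A] {a : Aˣ}

/-- The element `1 ⊗ s(e)` of the base change is an eigenvector of `e`: since `e s(e) = s(e) e`,
left multiplication by `e` acts on it as `x`, that is, as `a`. The universal property then carries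
`l ⋆ e^∞` to `1 ⊗ l s(e)`. -/
theorem one_tmul_eq_zero_of_twistedRep (ha : algebraMap K[X] A X = a) {l : LeavittPathAlgebra K E}
    (h : twistedRep K e a l (of A (.inf e)) = 0) :
    (1 : A) ⊗ₜ[K[X]] e.toPoly K (l * e.baseElem K) = 0 := by
  let ρ : LeavittPathAlgebra K E →ₙ+* Module.End A (A ⊗[K[X]] e.PolyModule K) :=
    (Module.End.baseChangeHom K[X] A (e.PolyModule K)).toRingHom.toNonUnitalRingHom.comp
      (e.leftMulPoly K)
  have hρ (l y : LeavittPathAlgebra K E) (b : A) :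
      ρ l (b ⊗ₜ e.toPoly K y) = b ⊗ₜ e.toPoly K (l * y) := rfl
  have hK (c : K) (l x) : ρ (c • l) x = algebraMap K A c • ρ l x := by
    induction x using TensorProduct.induction_on with
    | zero => simp
    | add x y hx hy => rw [map_add, map_add, smul_add, hx, hy]
    | tmul b m =>
      obtain ⟨y, rfl⟩ := (e.toPoly K).surjective m
      rw [hρ, hρ, smul_mul_assoc, map_smul, ← Cycle.C_smul_poly, ← TensorProduct.smul_tmul,
        IsScalarTower.algebraMap_apply K K[X] A, smul_tmul', algebra_compatible_smul A (C c)]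
      rfl
  have he : ρ (e.elem K) (1 ⊗ₜ e.toPoly K (e.baseElem K)) =
      a • (1 ⊗ₜ e.toPoly K (e.baseElem K) : A ⊗[K[X]] e.PolyModule K) := by
    have h0 : e.toPoly K (e.elem K * e.baseElem K) = (X : K[X]) • e.toPoly K (e.baseElem K) := by
      rw [e.elem_mul_baseElem, ← e.toPoly_mul_elem, e.baseElem_mul_elem]
    rw [hρ, h0, ← TensorProduct.smul_tmul, algebra_compatible_smul A X, ha, ← smul_tmul']
    rfl
  obtain ⟨ψ, hψ, hequiv⟩ := exists_equivariant ρ hK he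
  rw [← hρ, ← hψ, ← hequiv, h, map_zero]

/-- Evaluation at `e^∞` is `K[x]`-linear: a right factor `e` meets `e^∞` first and becomes the
scalar `a`, which passes through the `A`-linear action. -/
theorem twistedRep_poly_smul (ha : algebraMap K[X] A X = a) (q : K[X]) (m : e.PolyModule K) :
    twistedRep K e a ((e.toPoly K).symm (q • m)) (of A (.inf e)) =
      algebraMap K[X] A q • twistedRep K e a ((e.toPoly K).symm m) (of A (.inf e)) := by
  induction q using Polynomial.induction_on' with
  | add p q hp hq =>
    rw [add_smul, map_add, map_add, map_add, add_smul, LinearMap.add_apply, hp, hq]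
  | monomial n c =>
    rw [← C_mul_X_pow_eq_monomial, mul_smul, Cycle.C_smul_poly, map_smul, twistedRep_smul, map_mul,
      mul_smul, LinearMap.smul_apply, IsScalarTower.algebraMap_apply K K[X] A]
    refine congrArg _ ?_
    induction n with
    | zero => rw [pow_zero, one_smul, map_one, one_smul]
    | succ n ih =>
      rw [pow_succ', mul_smul, Cycle.toPoly_symm_X_smul, map_mul, Module.End.mul_apply,
        twistedRep_elem_inf, Units.smul_def, map_smul, ih, map_mul, mul_smul, ha]

theorem twistedRep_mul_evalElem (ha : algebraMap K[X] A X = a) (q : K[X])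
    (l : LeavittPathAlgebra K E) :
    twistedRep K e a (l * e.evalElem q) (of A (.inf e)) =
      algebraMap K[X] A q • twistedRep K e a l (of A (.inf e)) := by
  have := e.toPoly_symm_smul_mul q (e.toPoly K l)
  rw [LinearEquiv.symm_apply_apply] at this
  rw [← this, map_mul, Module.End.mul_apply, twistedRep_base_inf, twistedRep_poly_smul ha,
    LinearEquiv.symm_apply_apply]

variable (K) in
-- Polynomials in `e` produce every scalar multiple of `e^∞`, because `K[x]` maps onto `A`; edges
-- then prolong `e^∞` to any path of the class.
theorem smul_of_mem_range_twistedRep (ha : algebraMap K[X] A X = a)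
    (hsurj : Function.Surjective (algebraMap K[X] A)) (q : e.TailClass) (c : A) :
    ∃ l : LeavittPathAlgebra K E,
      twistedRep K e a (l * e.baseElem K) (of A (.inf e)) = c • of A q := by
  obtain ⟨n, hn⟩ := q.tail_eq
  induction n generalizing q c with
  | zero =>
    obtain rfl : q = .inf e := by
      obtain ⟨p, hp⟩ := q
      obtain rfl : p = e.inf := InfPath.ext fun k => by simpa using hn k
      rfl
    obtain ⟨r, rfl⟩ := hsurj c
    refine ⟨e.baseElem K * e.evalElem r, ?_⟩
    rw [mul_assoc, e.evalElem_mul_baseElem, twistedRep_mul_evalElem ha, twistedRep_base_inf]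
  | succ n ih =>
    -- The scalar is divided in advance by the weight that the first edge of `q` will contribute.
    obtain ⟨l, hl⟩ := ih q.tail ((e.weight a q.head)⁻¹ • c) fun k => by
      rw [← hn k, Nat.add_right_comm]
      rfl
    refine ⟨(LeavittPathAlgebra.family K E).edge q.head * l, ?_⟩
    classical
    rw [mul_assoc, map_mul, Module.End.mul_apply, hl, map_smul, twistedRep_edge_of,
      dif_pos q.tgt_head, q.cons_tail]
    change ((e.weight a q.head)⁻¹ • c) • (e.weight a q.head : A) • of A q = _
    rw [smul_smul, Units.smul_def, smul_eq_mul, mul_right_comm, Units.inv_mul, one_mul]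

theorem twistedRep_surjective (ha : algebraMap K[X] A X = a)
    (hsurj : Function.Surjective (algebraMap K[X] A)) (m : ChenModule A e) :
    ∃ l : LeavittPathAlgebra K E, twistedRep K e a (l * e.baseElem K) (of A (.inf e)) = m := by
  induction m using Finsupp.induction_linear with
  | zero => exact ⟨0, by rw [zero_mul, map_zero]; rfl⟩
  | add m m' hm hm' =>
    obtain ⟨l, rfl⟩ := hm
    obtain ⟨l', rfl⟩ := hm'
    exact ⟨l + l', by rw [add_mul, map_add]; rfl⟩
  | single q c =>
    obtain ⟨l, hl⟩ := smul_of_mem_range_twistedRep K ha hsurj q c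
    exact ⟨l, hl.trans (Finsupp.smul_single_one q c)⟩

end Kernel

/-! ### The kernel for `K[x]/(p)`, and injectivity of right multiplication by `p(e)` -/

section Field

variable {K : Type u} [Field K] {E : DiGraph.{v, w}} {e : E.Cycle} {p : K[X]}

theorem isScalarTower_adjoinRoot :
    letI : Algebra K[X] (AdjoinRoot p) := (AdjoinRoot.mk p).toAlgebra
    IsScalarTower K K[X] (AdjoinRoot p) :=
  letI : Algebra K[X] (AdjoinRoot p) := (AdjoinRoot.mk p).toAlgebra
  .of_algebraMap_eq fun _ => rfl

theorem mem_evalIdeal_of_twistedRep (hp : p.eval 0 = -1) {l : LeavittPathAlgebra K E}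
    (hl : l * e.baseElem K = l) (h : twistedRep K e (rootUnit p hp) l (of _ (.inf e)) = 0) :
    ∃ y, y * e.evalElem p = l := by
  let : Algebra K[X] (AdjoinRoot p) := (AdjoinRoot.mk p).toAlgebra
  have : IsScalarTower K K[X] (AdjoinRoot p) := isScalarTower_adjoinRoot
  have h1 := one_tmul_eq_zero_of_twistedRep (show algebraMap K[X] (AdjoinRoot p) X = _ from rfl) h
  rw [hl] at h1
  have h2 : (Ideal.Quotient.mk (Ideal.span {p}) 1) ⊗ₜ[K[X]] e.toPoly K l = 0 := h1
  -- Under `K[x]/(p) ⊗ L ≅ L/pL` the vanishing says `l = p · m`; multiplying by `s(e)` on the right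
  -- turns this into `l = m p(e)`.
  have h3 := congrArg (quotTensorEquivQuotSMul (e.PolyModule K) (Ideal.span {p})) h2
  rw [map_zero, quotTensorEquivQuotSMul_mk_tmul, one_smul, Submodule.Quotient.mk_eq_zero,
    Submodule.ideal_span_singleton_smul, Submodule.mem_smul_pointwise_iff_exists] at h3
  obtain ⟨m, -, hm⟩ := h3
  refine ⟨(e.toPoly K).symm m, ?_⟩
  rw [← e.toPoly_symm_smul_mul, hm, LinearEquiv.symm_apply_apply, hl]

/-- Right multiplication by `p(e)` is injective on `L_K(E) s(e)` if `p(0) ≠ 0`. -/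
theorem eq_zero_of_mul_evalElem (hp : p.eval 0 ≠ 0) {l : LeavittPathAlgebra K E}
    (hl : l * e.baseElem K = l) (h : l * e.evalElem p = 0) : l = 0 := by
  -- Inverting `x` makes it a unit, as the twist requires, while keeping a domain in which `p ≠ 0`.
  let S := Submonoid.powers (X : K[X])
  let A := Localization S
  have hS : S ≤ nonZeroDivisors K[X] := powers_le_nonZeroDivisors_of_noZeroDivisors X_ne_zero
  have : IsDomain A := IsLocalization.isDomain_localization hS
  obtain ⟨a, ha⟩ := IsLocalization.map_units A (⟨X, Submonoid.mem_powers X⟩ : S)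
  have h1 : algebraMap K[X] A p • twistedRep K e a l (of A (.inf e)) = 0 := by
    rw [← twistedRep_mul_evalElem ha.symm, h, map_zero, LinearMap.zero_apply]
  have hp0 : algebraMap K[X] A p ≠ 0 := fun h0 => hp <| by
    rw [(map_eq_zero_iff _ (IsLocalization.injective A hS)).1 h0, eval_zero]
  have h2 : twistedRep K e a l (of A (.inf e)) = 0 := Finsupp.ext fun q =>
    (mul_eq_zero.1 (DFunLike.congr_fun (F := e.TailClass →₀ A) h1 q)).resolve_left hp0
  have h3 := one_tmul_eq_zero_of_twistedRep ha.symm h2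
  rw [hl] at h3
  -- The base change is a localized module, so `1 ⊗ l = 0` means that a power of `x` kills `l`.
  obtain ⟨⟨_, n, rfl⟩, hn⟩ :=
    (IsLocalizedModule.eq_zero_iff S (TensorProduct.mk K[X] A (e.PolyModule K) 1)).1 h3
  have hn' : (X ^ n : K[X]) • e.toPoly K l = 0 := hn
  have hpl : p • e.toPoly K l = 0 := by
    rw [← LinearEquiv.map_eq_zero_iff (e.toPoly K).symm, e.toPoly_symm_smul hl, h]
  have hXp : IsCoprime (X : K[X]) p :=
    (irreducible_X.coprime_iff_not_dvd).2 fun hd => hp (dvd_iff_isRoot.1 (by simpa using hd))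
  obtain ⟨u, w, huw⟩ := hXp.pow_left (m := n)
  have h4 : (1 : K[X]) • e.toPoly K l = 0 := by
    rw [← huw, add_smul, mul_smul, mul_smul, hn', hpl, smul_zero, smul_zero, add_zero]
  rwa [one_smul, LinearEquiv.map_eq_zero_iff] at h4

end Field
end

noncomputable section

open DiGraph LeavittPathAlgebra ChenModule

/-! ### Modules over rings without unit: transport, and left ideals of idempotents -/

namespace LeftMod

variable {R : Type u} [NonUnitalRing R] {M : Type v} [AddCommGroup M] [LeftMod R M]
  {N : Type w} [AddCommGroup N] [LeftMod R N]

/-- The composition of two module homomorphisms. -/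
def Hom.comp {P : Type x} [AddCommGroup P] [LeftMod R P] (g : Hom R N P) (f : Hom R M N) :
    Hom R M P where
  toAddMonoidHom := g.toAddMonoidHom.comp f.toAddMonoidHom
  map_smul' r m := (congrArg g (f.map_smul' r m)).trans (g.map_smul' r (f m))

theorem Hom.comp_apply {P : Type x} [AddCommGroup P] [LeftMod R P] (g : Hom R N P) (f : Hom R M N)
    (m : M) : g.comp f m = g (f m) := rfl

/-- The inverse of a bijective module homomorphism. -/
def Hom.inverse (f : Hom R M N) (hf : Function.Bijective f) : Hom R N M where
  toAddMonoidHom := (AddEquiv.ofBijective f.toAddMonoidHom hf).symm.toAddMonoidHom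
  map_smul' r n := hf.1 <| by
    have h (n : N) : f ((AddEquiv.ofBijective f.toAddMonoidHom hf).symm n) = n :=
      (AddEquiv.ofBijective f.toAddMonoidHom hf).apply_symm_apply n
    exact (h _).trans (((f.map_smul' r _).trans (congrArg (r • ·) (h n))).symm)

theorem Hom.inverse_apply_apply (f : Hom R M N) (hf : Function.Bijective f) (m : M) :
    f.inverse hf (f m) = m :=
  (AddEquiv.ofBijective f.toAddMonoidHom hf).symm_apply_apply m

theorem IsUnital.of_surjective (f : Hom R M N) (hf : Function.Surjective f) (h : IsUnital R M) :
    IsUnital R N := by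
  rw [IsUnital, eq_top_iff] at h ⊢
  rintro n -
  obtain ⟨m, rfl⟩ := hf n
  have hm := h (AddSubgroup.mem_top m)
  induction hm using AddSubgroup.closure_induction with
  | mem x hx =>
    obtain ⟨r, m, rfl⟩ := hx
    exact AddSubgroup.subset_closure ⟨r, f m, f.map_smul' r m⟩
  | zero => rw [map_zero]; exact zero_mem _
  | add x y _ _ hx hy => rw [map_add]; exact add_mem hx hy
  | neg x _ hx => rw [map_neg]; exact neg_mem hx

theorem IsFG.of_surjective (f : Hom R M N) (hf : Function.Surjective f) (h : IsFG R M) :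
    IsFG R N := by
  classical
  obtain ⟨s, hs⟩ := h
  refine ⟨s.image f, fun P hP => ?_⟩
  let Q : Sub R M :=
    { toAddSubgroup := P.toAddSubgroup.comap f.toAddMonoidHom
      smul_mem' := fun r m hm => by
        change f (r • m) ∈ P.toAddSubgroup
        have h : f (r • m) = r • f m := f.map_smul' r m
        rw [h]
        exact P.smul_mem' r hm }
  have hQ : Q.toAddSubgroup = ⊤ := hs Q fun m hm => hP _ (Finset.mem_image_of_mem _ hm)
  rw [eq_top_iff]
  rintro n -
  obtain ⟨m, rfl⟩ := hf n
  have : m ∈ Q.toAddSubgroup := hQ ▸ AddSubgroup.mem_top m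
  exact this

theorem IsProjective.of_bijective (f : Hom R M N) (hf : Function.Bijective f)
    (h : IsProjective.{u, v, z} R M) : IsProjective.{u, w, z} R N := by
  refine ⟨h.1.of_surjective f hf.2, fun A B _ _ _ _ hA hB g k hg => ?_⟩
  obtain ⟨l, hl⟩ := h.2 A B hA hB g (k.comp f) hg
  refine ⟨l.comp (f.inverse hf), fun n => ?_⟩
  obtain ⟨m, rfl⟩ := hf.2 n
  rw [Hom.comp_apply, Hom.inverse_apply_apply, hl, Hom.comp_apply]

section leftIdeal

variable {x : R}

theorem mem_leftIdeal {y : R} : y ∈ (leftIdeal x).toAddSubgroup ↔ ∃ a, a * x = y := Iff.rfl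

theorem mul_of_mem_leftIdeal (hx : IsIdempotentElem x) {y : R}
    (hy : y ∈ (leftIdeal x).toAddSubgroup) : y * x = y := by
  obtain ⟨a, rfl⟩ := mem_leftIdeal.1 hy
  rw [mul_assoc, hx.eq]

/-- An idempotent as an element of the left ideal which it generates. -/
def leftIdealGen (hx : IsIdempotentElem x) : (leftIdeal x).toAddSubgroup := ⟨x, x, hx.eq⟩

theorem smul_leftIdealGen (hx : IsIdempotentElem x) (y : (leftIdeal x).toAddSubgroup) :
    y.1 • leftIdealGen hx = y :=
  Subtype.ext (mul_of_mem_leftIdeal hx y.2)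

theorem isUnital_leftIdeal (hx : IsIdempotentElem x) :
    IsUnital R (leftIdeal x).toAddSubgroup := by
  rw [IsUnital, eq_top_iff]
  rintro y -
  exact AddSubgroup.subset_closure ⟨y.1, leftIdealGen hx, (smul_leftIdealGen hx y).symm⟩

theorem isFG_leftIdeal (hx : IsIdempotentElem x) : IsFG R (leftIdeal x).toAddSubgroup := by
  refine ⟨{leftIdealGen hx}, fun N hN => ?_⟩
  rw [eq_top_iff]
  rintro y -
  rw [← smul_leftIdealGen hx y]
  exact N.smul_mem' _ (hN _ (Finset.mem_singleton_self _))

/-- The homomorphism from `R x` to a module which maps `y` to `y m`. -/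
def leftIdealHom (x : R) (m : M) : Hom R (leftIdeal x).toAddSubgroup M where
  toFun y := y.1 • m
  map_zero' := by
    have h := LeftMod.add_smul (0 : R) 0 m
    rw [add_zero, left_eq_add] at h
    exact h
  map_add' y z := LeftMod.add_smul y.1 z.1 m
  map_smul' r y := LeftMod.mul_smul r y.1 m

theorem isProjective_leftIdeal (hx : IsIdempotentElem x) :
    IsProjective.{u, u, z} R (leftIdeal x).toAddSubgroup := by
  refine ⟨isUnital_leftIdeal hx, fun A B _ _ _ _ _ _ g f hg => ?_⟩
  -- Any preimage `m` of `f x` will do: `g (y m) = y f x = f (y x) = f y`, as `y x = y` on `R x`.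
  obtain ⟨m, hm⟩ := hg (f (leftIdealGen hx))
  refine ⟨leftIdealHom x m, fun y => ?_⟩
  have h1 := g.map_smul' y.1 m
  have h2 := f.map_smul' y.1 (leftIdealGen hx)
  rw [smul_leftIdealGen] at h2
  exact h1.trans ((congrArg (y.1 • ·) hm).trans h2.symm)

/-- Right multiplication by `y = x y`, as a homomorphism from `R x` to `R y`. -/
def leftIdealMulRight (x y : R) : Hom R (leftIdeal x).toAddSubgroup (leftIdeal y).toAddSubgroup where
  toFun a := ⟨a.1 * y, a.1, rfl⟩
  map_zero' := Subtype.ext (zero_mul y)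
  map_add' a b := Subtype.ext (add_mul a.1 b.1 y)
  map_smul' r a := Subtype.ext (mul_assoc r a.1 y)

/-- Surjectivity is `a y = (a x) y`; the last hypothesis is injectivity, since elements of `R x` are
fixed by `x` on the right. -/
theorem leftIdealMulRight_bijective {y : R} (hx : IsIdempotentElem x) (hxy : x * y = y)
    (h : ∀ a, a * x = a → a * y = 0 → a = 0) :
    Function.Bijective (leftIdealMulRight x y) := by
  refine ⟨(injective_iff_map_eq_zero (leftIdealMulRight x y).toAddMonoidHom).2 fun a ha => ?_, ?_⟩
  · exact Subtype.ext (h a.1 (mul_of_mem_leftIdeal hx a.2) (congrArg Subtype.val ha))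
  · rintro ⟨_, a, rfl⟩
    exact ⟨⟨a * x, a, rfl⟩, Subtype.ext ((mul_assoc a x y).trans (congrArg (a * ·) hxy))⟩

end leftIdeal

/-- The homomorphism induced on a quotient by a submodule. -/
def quotientLift (P : Sub R M) (f : Hom R M N) (h : ∀ m ∈ P.toAddSubgroup, f m = 0) :
    Hom R (M ⧸ P.toAddSubgroup) N where
  toAddMonoidHom := QuotientAddGroup.lift P.toAddSubgroup f.toAddMonoidHom h
  map_smul' r m := by
    induction m using QuotientAddGroup.induction_on with | _ m
    exact f.map_smul' r m

theorem quotientLift_bijective (P : Sub R M) (f : Hom R M N)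
    (h : ∀ m, m ∈ P.toAddSubgroup ↔ f m = 0) (hf : Function.Surjective f) :
    Function.Bijective (quotientLift P f fun m => (h m).1) := by
  refine ⟨(injective_iff_map_eq_zero (quotientLift P f _).toAddMonoidHom).2 fun a ha => ?_,
    fun n => ?_⟩
  · induction a using QuotientAddGroup.induction_on with | _ m
    exact (QuotientAddGroup.eq_zero_iff m).2 ((h m).2 ha)
  · obtain ⟨m, rfl⟩ := hf n
    exact ⟨QuotientAddGroup.mk m, rfl⟩

end LeftMod

/-! ### Assembling the resolution -/

section Resolution

variable {K : Type u} [Field K] {E : DiGraph.{v, w}} (e : E.Cycle) {p : K[X]}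

theorem evalIdeal_le_baseIdeal (p : K[X]) :
    (e.evalIdeal p).toAddSubgroup ≤ (e.baseIdeal K).toAddSubgroup := by
  rintro _ ⟨a, rfl⟩
  exact ⟨a * e.evalElem p, (mul_assoc ..).trans (congrArg (a * ·) (e.evalElem_mul_baseElem p))⟩

theorem toChen_apply (hp : p.eval 0 = -1) (l : (e.baseIdeal K).toAddSubgroup) :
    ChenModulePoly.toChen e p hp l =
      (twistedRep K e (rootUnit p hp) l.1 (of (AdjoinRoot p) (.inf e)) :
        ChenModule (AdjoinRoot p) e) := rfl

theorem toChen_surjective (hp : p.eval 0 = -1) :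
    Function.Surjective (ChenModulePoly.toChen e p hp) := by
  intro m
  let : Algebra K[X] (AdjoinRoot p) := (AdjoinRoot.mk p).toAlgebra
  have : IsScalarTower K K[X] (AdjoinRoot p) := isScalarTower_adjoinRoot
  obtain ⟨l, hl⟩ := twistedRep_surjective (K := K) (a := rootUnit p hp)
    (show algebraMap K[X] (AdjoinRoot p) X = _ from rfl) AdjoinRoot.mk_surjective m
  exact ⟨⟨_, l, rfl⟩, hl⟩

theorem toChen_eq_zero_iff (hp : p.eval 0 = -1) (l : (e.baseIdeal K).toAddSubgroup) :
    ChenModulePoly.toChen e p hp l = 0 ↔ l.1 ∈ (e.evalIdeal p).toAddSubgroup := by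
  rw [toChen_apply]
  constructor
  · exact fun h => mem_evalIdeal_of_twistedRep hp
      (LeftMod.mul_of_mem_leftIdeal e.baseElem_mul_self l.2) h
  · rintro ⟨y, hy⟩
    let : Algebra K[X] (AdjoinRoot p) := (AdjoinRoot.mk p).toAlgebra
    have : IsScalarTower K K[X] (AdjoinRoot p) := isScalarTower_adjoinRoot
    have hy' : y * e.evalElem p = l.1 := hy
    have h0 : algebraMap K[X] (AdjoinRoot p) p = 0 := AdjoinRoot.mk_self
    have h := twistedRep_mul_evalElem (e := e) (a := rootUnit p hp)
      (show algebraMap K[X] (AdjoinRoot p) X = _ from rfl) p y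
    rw [hy', h0, zero_smul] at h
    exact h

/-- This identifies `L p(e)` with `L s(e)`, and so transfers projectivity and finite generation to
an ideal whose given generator need not be idempotent. -/
theorem leftIdealMulRight_evalElem_bijective (hp : p.eval 0 = -1) :
    Function.Bijective (LeftMod.leftIdealMulRight (e.baseElem K) (e.evalElem p)) :=
  LeftMod.leftIdealMulRight_bijective e.baseElem_mul_self (e.baseElem_mul_evalElem p)
    fun _ => eq_zero_of_mul_evalElem (by simp [hp])

end Resolution

end

theorem theorem4p3 {K : Type u} [Field K] (E : DiGraph.{v, w}) (e : E.Cycle) (p : K[X])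
    (hp : IsBasicIrreducible p) :
    LeftMod.IsFinitelyPresented.{max u v w, max u w, z} (LeavittPathAlgebra K E)
      (ChenModulePoly e p hp.eval_zero) ∧
    (∃ h : (e.evalIdeal p).toAddSubgroup ≤ (e.baseIdeal K).toAddSubgroup,
      LeftMod.IsProjectiveResolution.{max u v w, max u w, max u v w, max u v w, z}
        (LeftMod.Sub.inclusion h)
        (ChenModulePoly.toChen e p hp.eval_zero)) ∧
    ∃ φ : LeftMod.Hom (LeavittPathAlgebra K E)
        ((e.baseIdeal K).toAddSubgroup ⧸ ((e.evalIdeal p).within (e.baseIdeal K)).toAddSubgroup)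
        (ChenModulePoly e p hp.eval_zero), Function.Bijective φ := by
  have hv : IsIdempotentElem (e.baseElem K) := e.baseElem_mul_self
  have hle := evalIdeal_le_baseIdeal e p
  have hbij := leftIdealMulRight_evalElem_bijective e hp.eval_zero
  have hsurj := toChen_surjective e hp.eval_zero
  have hexact : Function.Exact (LeftMod.Sub.inclusion hle)
      (ChenModulePoly.toChen e p hp.eval_zero) := fun l =>
    (toChen_eq_zero_iff e hp.eval_zero l).trans
      ⟨fun h => ⟨⟨l.1, h⟩, rfl⟩, by rintro ⟨y, rfl⟩; exact y.2⟩
  have hP := LeftMod.isProjective_leftIdeal.{max u v w, z} hv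
  have hQ := hP.of_bijective _ hbij
  have hFG := LeftMod.isFG_leftIdeal hv
  -- The resolution itself serves as the finite presentation, with `Q = L p(e)` and `P = L s(e)`.
  refine ⟨⟨_, _, _, _, _, _, LeftMod.Sub.inclusion hle, _, hFG.of_surjective _ hbij.2, hQ, hFG, hP,
    hexact, hsurj⟩, ⟨hle, (LeftMod.isUnital_leftIdeal hv).of_surjective _ hsurj, hQ, hP,
    AddSubgroup.inclusion_injective hle, hexact, hsurj⟩, _,
    LeftMod.quotientLift_bijective _ _ (fun l => (toChen_eq_zero_iff e hp.eval_zero l).symm) hsurj⟩
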